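/- **Corollary 4.10.** Let $Q$ be a finite, connected (in particular non-empty), acyclic quiver, and let $\mathcal D=\mathcal D^b(\mathrm{mod}\,\mathbb CQ)$ be the bounded derived category of its finite-dimensional complex representations (equivalently, of finitely generated $\mathbb CQ$-modules), with Grothendieck group $K(\mathcal D)$. Let $\mathrm{Stab}_K(\mathcal D)$ be the space of Bridgeland stability conditions $\sigma=(Z_\sigma,\mathcal P_\sigma)$ on $\mathcal D$ with $Z_\sigma\colon K(\mathcal D)\to\mathbb C$ satisfying the support property, with the topology induced by the generalized metric $$d_B(\sigma,\tau)=\sup_{E\ne0}\Big\{|\phi^+_\sigma(E)-\phi^+_\tau(E)|,\ |\phi^-_\sigma(E)-\phi^-_\tau(E)|,\ \Big|\log\frac{m_\sigma(E)}{m_\tau(E)}\Big|\Big\}\in[0,\infty],$$ where $\phi^+_\sigma(E)$, $\phi^-_\sigma(E)$ are the largest and the smallest phase of the Harder–Narasimhan factors $A_i$ of $E$ and $m_\sigma(E)=\sum_i|Z_\sigma(A_i)|$. Let $\mathrm{Stab}^\dagger_K(\mathcal D)$ be the connected component that contains all stability conditions with heart $\mathcal P((0,1])=\mathrm{mod}\,\mathbb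 CQ$. An exact autoequivalence $F$ acts by $F.\sigma=(Z_\sigma\circ K(F^{-1}),\{F(\mathcal P_\sigma(\phi))\})$. An element $g=(M,f)$ of the universal cover $\widetilde{\mathrm{GL}}_+(2,\mathbb R)$ (with $M\in\mathrm{GL}_+(2,\mathbb R)$, and $f\colon\mathbb R\to\mathbb R$ increasing with $f(\phi+1)=f(\phi)+1$, inducing the same map on $(\mathbb R^2\setminus0)/\mathbb R_{>0}=\mathbb R/2\mathbb Z$) acts by $\sigma.g=(M^{-1}\circ Z_\sigma,\{\mathcal P_\sigma(f(\phi))\})$; in particular $\lambda\in\mathbb C$ acts by $\sigma.\lambda=(e^{-i\pi\lambda}Z_\sigma,\{\mathcal P_\sigma(\phi+\mathrm{Re}\,\lambda)\})$. Put $\bar d_B(\bar\sigma,\bar\tau)=\inf_{\lambda\in\mathbb C}d_B(\sigma,\tau.\lambda)$. Let $F$ be an exact autoequivalence of $\mathcal D$ that is pseudo-Anosov with $\sigma_F\in\mathrm{Stab}^\dagger_K(\mathcal D)$: there are $\sigma_F\in\mathrm{Stab}^\dagger_K(\mathcal D)$, a real number $r$ with $|r|>1$, and $g_F=(M,f)\in\widetilde{\mathrm{GL}}_+(2,\mathbb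 R)$ with $M=\begin{pmatrix}1/r&0\\0&r\end{pmatrix}$ or $M=\begin{pmatrix}r&0\\0&1/r\end{pmatrix}$, such that $F.\sigma_F=\sigma_F.g_F$. Let $\rho_F=|r|$ be the stretch factor. Then $$h(F)=\log\rho_F=\bar d_B(F).$$ Here $\bar d_B(F)=\inf_{\bar\sigma\in\mathrm{Stab}^\dagger_K(\mathcal D)/\mathbb C}\bar d_B(\bar\sigma,F.\bar\sigma)$ is the translation length, and $h(F)=\lim_{n\to\infty}\frac1n\log\delta(G,F^nG)$ is the entropy, for any split generator $G$ of $\mathcal D$ (split generators exist, and the limit exists and is the same for all of them), where $\delta(G,E)$ is the least $p>0$ such that, for some object $M$ and some integers $n_1,\dots,n_p$, the object $E\oplus M$ is the end of a tower of $p$ exact triangles, starting at $0$, with successive cones $G[n_1],\dots,G[n_p]$. -/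

import Mathlib

open CategoryTheory Limits Pretriangulated
open scoped TensorProduct MatrixGroups

universe w v u

namespace StabMetric

noncomputable section

/-! ### Grothendieck group -/

section General

variable {T : Type u} [Category.{v} T] [HasZeroObject T] [HasShift T ℤ] [Preadditive T]
  [∀ n : ℤ, (shiftFunctor T n).Additive] [Pretriangulated T]

variable (T) in
/-- The relations `[X] - [Y] + [Z]`, one for each exact triangle `X → Y → Z → X[1]`. -/
def k0Relations : AddSubgroup (FreeAbelianGroup T) :=
  AddSubgroup.closure {x | ∃ t : Triangle T, t ∈ (distTriang T) ∧
    x = FreeAbelianGroup.of t.obj₁ - FreeAbelianGroup.of t.obj₂ + FreeAbelianGroup.of t.obj₃}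

variable (T) in
/-- The Grothendieck group of a triangulated category. -/
abbrev K0 : Type u := FreeAbelianGroup T ⧸ k0Relations T

/-- The class of an object in the Grothendieck group. -/
def K0.cls (E : T) : K0 T := QuotientAddGroup.mk (FreeAbelianGroup.of E)

lemma K0.cls_triangle (t : Triangle T) (ht : t ∈ (distTriang T)) :
    K0.cls t.obj₁ - K0.cls t.obj₂ + K0.cls t.obj₃ = 0 :=
  (QuotientAddGroup.eq_zero_iff _).2 (AddSubgroup.subset_closure ⟨t, ht, rfl⟩)

open ZeroObject in
lemma K0.cls_iso {E E' : T} (e : E ≅ E') : K0.cls E = K0.cls E' := by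
  have h0 : K0.cls (0 : T) = 0 := by
    simpa using K0.cls_triangle _ (contractible_distinguished (0 : T))
  have h := K0.cls_triangle (Triangle.mk e.hom (0 : E' ⟶ (0 : T)) 0)
    (isomorphic_distinguished _ (contractible_distinguished E) _
      (Triangle.isoMk _ _ (Iso.refl E) e.symm (Iso.refl (0 : T)) 
        (e.hom_inv_id.trans (Category.comp_id (𝟙 E)).symm)
        ((isZero_zero T).eq_of_tgt _ _) ((isZero_zero T).eq_of_src _ _)))
  simp only [Triangle.mk_obj₁, Triangle.mk_obj₂, Triangle.mk_obj₃, h0, add_zero] at h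
  exact sub_eq_zero.1 h

/-- The homomorphism of Grothendieck groups induced by an exact functor. -/
def K0.map (F : T ⥤ T) [F.CommShift ℤ] [F.IsTriangulated] : K0 T →+ K0 T :=
  QuotientAddGroup.map (k0Relations T) (k0Relations T) (FreeAbelianGroup.map F.obj) (by
    rw [k0Relations, AddSubgroup.closure_le]
    rintro _ ⟨t, ht, rfl⟩
    refine AddSubgroup.subset_closure ⟨F.mapTriangle.obj t, F.map_distinguished t ht, ?_⟩
    simp)

@[simp]
lemma K0.map_cls (F : T ⥤ T) [F.CommShift ℤ] [F.IsTriangulated] (E : T) :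
    K0.map F (K0.cls E) = K0.cls (F.obj E) := by
  simp [K0.map, K0.cls]

lemma K0.hom_ext {A : Type*} [AddCommGroup A] {f g : K0 T →+ A}
    (h : ∀ E, f (K0.cls E) = g (K0.cls E)) : f = g := by
  apply QuotientAddGroup.addMonoidHom_ext
  ext E
  exact h E

/-! ### Towers of exact triangles, Harder--Narasimhan filtrations -/

/-- `E` is the end of a tower `0 = E₀ → E₁ → ⋯ → E_p ≅ E` of exact triangles
`E_i → E_{i+1} → A_i → E_i[1]` whose cones are the given objects `A_0, …, A_{p-1}`. -/
def IsTower {p : ℕ} (A : Fin p → T) (E : T) : Prop :=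
  ∃ X : Fin (p + 1) → T, IsZero (X 0) ∧ Nonempty (X (Fin.last p) ≅ E) ∧
    ∀ i : Fin p, ∃ (f : X i.castSucc ⟶ X i.succ) (g : X i.succ ⟶ A i)
      (h : A i ⟶ (X i.castSucc)⟦(1 : ℤ)⟧), Triangle.mk f g h ∈ (distTriang T)

/-- A Harder--Narasimhan filtration of `E` with respect to the family `P`:
nonzero factors `A_0, …, A_n`, with `A_i` in `P (φ_i)` and `φ_0 > φ_1 > ⋯ > φ_n`. -/
structure HNFiltration (P : ℝ → ObjectProperty T) (E : T) where
  n : ℕ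
  factor : Fin (n + 1) → T
  phase : Fin (n + 1) → ℝ
  factor_mem : ∀ i, P (phase i) (factor i)
  factor_ne_zero : ∀ i, ¬ IsZero (factor i)
  phase_strictAnti : StrictAnti phase
  tower : IsTower factor E

variable (T) in
/-- A Bridgeland stability condition on `T` with respect to `Λ = K₀(T)` and `v = id`.
In the support property the norm on `K₀(T) ⊗ ℝ` is existentially quantified: the property does
not depend on it if `K₀(T)` is finitely generated. -/
@[ext]
structure StabilityCondition where
  Z : K0 T →+ ℂ
  P : ℝ → ObjectProperty T
  P_iso : ∀ φ {E E' : T}, (E ≅ E') → P φ E → P φ E'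
  P_zero : ∀ φ {E : T}, IsZero E → P φ E
  P_biprod : ∀ φ {E E' : T}, P φ E → P φ E' → P φ (E ⊞ E')
  phase_eq : ∀ φ E, P φ E → ¬ IsZero E →
    ∃ m : ℝ, 0 < m ∧ Z (K0.cls E) = m * Complex.exp (Complex.I * Real.pi * φ)
  P_shift : ∀ φ E, P (φ + 1) E ↔ ∃ E', P φ E' ∧ Nonempty (E ≅ E'⟦(1 : ℤ)⟧)
  hom_eq_zero : ∀ φ₁ φ₂, φ₂ < φ₁ → ∀ E₁ E₂, P φ₁ E₁ → P φ₂ E₂ → ∀ f : E₁ ⟶ E₂, f = 0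
  exists_hn : ∀ E, ¬ IsZero E → Nonempty (HNFiltration P E)
  support : ∃ N : Seminorm ℝ (ℝ ⊗[ℤ] K0 T), (∀ x, N x = 0 → x = 0) ∧ ∃ C : ℝ, 0 < C ∧
    ∀ φ E, P φ E → ¬ IsZero E → N ((1 : ℝ) ⊗ₜ[ℤ] K0.cls E) < C * ‖Z (K0.cls E)‖

namespace StabilityCondition

/-- The Harder--Narasimhan filtration of a nonzero object. -/
def hn (σ : StabilityCondition T) (E : {E : T // ¬ IsZero E}) : HNFiltration σ.P E.1 :=
  Classical.choice (σ.exists_hn E.1 E.2)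

/-- The largest phase `φ⁺_σ(E)`. -/
def phiPlus (σ : StabilityCondition T) (E : {E : T // ¬ IsZero E}) : ℝ := (σ.hn E).phase 0

/-- The smallest phase `φ⁻_σ(E)`. -/
def phiMinus (σ : StabilityCondition T) (E : {E : T // ¬ IsZero E}) : ℝ :=
  (σ.hn E).phase (Fin.last _)

/-- The mass `m_σ(E)`. -/
def mass (σ : StabilityCondition T) (E : {E : T // ¬ IsZero E}) : ℝ :=
  ∑ i, ‖σ.Z (K0.cls ((σ.hn E).factor i))‖

lemma mass_pos (σ : StabilityCondition T) (E : {E : T // ¬ IsZero E}) : 0 < σ.mass E := by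
  refine Finset.sum_pos (fun i _ => ?_) Finset.univ_nonempty
  obtain ⟨m, hm, h⟩ := σ.phase_eq _ _ ((σ.hn E).factor_mem i) ((σ.hn E).factor_ne_zero i)
  rw [h, norm_pos_iff]
  exact mul_ne_zero (by exact_mod_cast hm.ne') (Complex.exp_ne_zero _)

/-- Bridgeland's generalized metric
`d_B(σ, τ) = sup_{E ≠ 0} {|φ⁺_σ(E) - φ⁺_τ(E)|, |φ⁻_σ(E) - φ⁻_τ(E)|, |log (m_σ(E) / m_τ(E))|}`. -/
def dB (σ τ : StabilityCondition T) : ENNReal :=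
  ⨆ E : {E : T // ¬ IsZero E},
    max (max (ENNReal.ofReal |σ.phiPlus E - τ.phiPlus E|)
      (ENNReal.ofReal |σ.phiMinus E - τ.phiMinus E|))
      (ENNReal.ofReal |Real.log (σ.mass E / τ.mass E)|)

lemma dB_eq (σ τ : StabilityCondition T) : dB σ τ =
    ⨆ E : {E : T // ¬ IsZero E},
      edist (σ.phiPlus E, σ.phiMinus E, Real.log (σ.mass E))
        (τ.phiPlus E, τ.phiMinus E, Real.log (τ.mass E)) := by
  refine iSup_congr fun E => ?_
  rw [Real.log_div (σ.mass_pos E).ne' (τ.mass_pos E).ne', Prod.edist_eq, Prod.edist_eq]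
  simp only [edist_dist, Real.dist_eq, max_assoc]

/-- The topology of the space of stability conditions is the one induced by `d_B`. -/
instance : PseudoEMetricSpace (StabilityCondition T) where
  edist := dB
  edist_self σ := by
    simp [dB_eq]
  edist_comm σ τ := by
    simp only [dB_eq, edist_comm]
  edist_triangle σ τ υ := by
    simp only [dB_eq]
    exact iSup_le fun E => (edist_triangle _ (τ.phiPlus E, τ.phiMinus E, Real.log (τ.mass E)) _).trans
      (add_le_add (le_iSup (fun E => edist (σ.phiPlus E, σ.phiMinus E, Real.log (σ.mass E))
        (τ.phiPlus E, τ.phiMinus E, Real.log (τ.mass E))) E)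
        (le_iSup (fun E => edist (τ.phiPlus E, τ.phiMinus E, Real.log (τ.mass E))
        (υ.phiPlus E, υ.phiMinus E, Real.log (υ.mass E))) E))

end StabilityCondition

/-- The smallest full subcategory closed under extensions and containing `P`. -/
inductive ExtClosure (P : ObjectProperty T) : T → Prop
  | of (E : T) : P E → ExtClosure P E
  | ext (t : Triangle T) : t ∈ (distTriang T) → ExtClosure P t.obj₁ → ExtClosure P t.obj₃ →
      ExtClosure P t.obj₂

/-- The subcategory `P(I)`, the extension closure of the `P(φ)` with `φ ∈ I`. -/
def StabilityCondition.PInterval (σ : StabilityCondition T) (I : Set ℝ) : ObjectProperty T :=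
  ExtClosure fun E => ∃ φ ∈ I, σ.P φ E

/-- The heart `P((0, 1])` of a stability condition. -/
def StabilityCondition.heart (σ : StabilityCondition T) : ObjectProperty T :=
  σ.PInterval (Set.Ioc 0 1)

/-! ### The action of the universal cover of `GL₊(2, ℝ)` -/

/-- The action of a real `2 × 2` matrix on the column vectors of `ℝ² = ℂ`, `(x, y) = x + iy`. -/
def planeMap (A : Matrix (Fin 2) (Fin 2) ℝ) : ℂ →+ ℂ where
  toFun z := ⟨A 0 0 * z.re + A 0 1 * z.im, A 1 0 * z.re + A 1 1 * z.im⟩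
  map_zero' := by simp [Complex.ext_iff]
  map_add' z w := by simp [Complex.ext_iff]; constructor <;> ring

lemma planeMap_apply (A : Matrix (Fin 2) (Fin 2) ℝ) (z : ℂ) : planeMap A z =
    ⟨A 0 0 * z.re + A 0 1 * z.im, A 1 0 * z.re + A 1 1 * z.im⟩ := rfl

lemma planeMap_mul (A B : Matrix (Fin 2) (Fin 2) ℝ) (z : ℂ) :
    planeMap (A * B) z = planeMap A (planeMap B z) := by
  simp only [planeMap_apply, Complex.ext_iff, Matrix.mul_apply, Fin.sum_univ_two]
  constructor <;> ring

lemma planeMap_one (z : ℂ) : planeMap 1 z = z := by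
  simp [planeMap_apply]

lemma planeMap_real_mul (A : Matrix (Fin 2) (Fin 2) ℝ) (c : ℝ) (z : ℂ) :
    planeMap A (c * z) = c * planeMap A z := by
  simp only [planeMap_apply, Complex.ext_iff, Complex.mul_re, Complex.mul_im, Complex.ofReal_re,
    Complex.ofReal_im]
  constructor <;> ring

lemma norm_planeMap_le (A : Matrix (Fin 2) (Fin 2) ℝ) (z : ℂ) :
    ‖planeMap A z‖ ≤ (|A 0 0| + |A 0 1| + |A 1 0| + |A 1 1|) * ‖z‖ := by
  have hr := Complex.abs_re_le_norm z
  have hi := Complex.abs_im_le_norm z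
  calc ‖planeMap A z‖ ≤ |A 0 0 * z.re + A 0 1 * z.im| + |A 1 0 * z.re + A 1 1 * z.im| :=
        Complex.norm_le_abs_re_add_abs_im _
    _ ≤ (|A 0 0| * |z.re| + |A 0 1| * |z.im|) + (|A 1 0| * |z.re| + |A 1 1| * |z.im|) := by
        gcongr
        · exact (abs_add_le _ _).trans (by rw [abs_mul, abs_mul])
        · exact (abs_add_le _ _).trans (by rw [abs_mul, abs_mul])
    _ ≤ (|A 0 0| * ‖z‖ + |A 0 1| * ‖z‖) + (|A 1 0| * ‖z‖ + |A 1 1| * ‖z‖) := by gcongr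
    _ = _ := by ring

/-- The universal cover of `GL₊(2, ℝ)`, as the group of pairs `(M, f)` with `f : ℝ → ℝ` increasing
and `f (φ + 1) = f φ + 1`, such that `M` and `f` induce the same map on
`(ℝ² ∖ 0) / ℝ_{>0} = ℝ / 2ℤ`. Such an `f` is automatically bijective. -/
structure GLTilde where
  M : Matrix (Fin 2) (Fin 2) ℝ
  det_pos : 0 < M.det
  f : ℝ ≃o ℝ
  f_add_one : ∀ φ, f (φ + 1) = f φ + 1
  compat : ∀ φ : ℝ, ∃ c : ℝ, 0 < c ∧
    planeMap M (Complex.exp (Complex.I * Real.pi * φ)) =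
      c * Complex.exp (Complex.I * Real.pi * f φ)

namespace GLTilde

lemma inv_mul (g : GLTilde) : g.M⁻¹ * g.M = 1 :=
  Matrix.nonsing_inv_mul _ g.det_pos.ne'.isUnit

lemma mul_inv (g : GLTilde) : g.M * g.M⁻¹ = 1 :=
  Matrix.mul_nonsing_inv _ g.det_pos.ne'.isUnit

/-- `ℂ` as a subgroup of the universal cover: `c` corresponds to multiplication by `exp (iπc)`
together with `φ ↦ φ + Re c`. -/
def ofComplex (c : ℂ) : GLTilde where
  M := !![(Complex.exp (Complex.I * Real.pi * c)).re, -(Complex.exp (Complex.I * Real.pi * c)).im;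
    (Complex.exp (Complex.I * Real.pi * c)).im, (Complex.exp (Complex.I * Real.pi * c)).re]
  det_pos := by
    have := Complex.normSq_pos.2 (Complex.exp_ne_zero (Complex.I * Real.pi * c))
    rw [Complex.normSq_apply] at this
    rw [Matrix.det_fin_two_of]
    linarith
  f := OrderIso.addRight c.re
  f_add_one φ := by simp only [OrderIso.addRight_apply]; ring
  compat φ := by
    refine ⟨Real.exp (-(Real.pi * c.im)), Real.exp_pos _, ?_⟩
    have h : planeMap !![(Complex.exp (Complex.I * Real.pi * c)).re,
        -(Complex.exp (Complex.I * Real.pi * c)).im;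
        (Complex.exp (Complex.I * Real.pi * c)).im, (Complex.exp (Complex.I * Real.pi * c)).re]
        (Complex.exp (Complex.I * Real.pi * φ)) =
        Complex.exp (Complex.I * Real.pi * c) * Complex.exp (Complex.I * Real.pi * φ) := by
      simp only [planeMap_apply, Complex.ext_iff, Complex.mul_re, Complex.mul_im]
      constructor <;> simp <;> ring
    rw [h, Complex.ofReal_exp, ← Complex.exp_add, ← Complex.exp_add, OrderIso.addRight_apply]
    congr 1
    conv_lhs => rw [← Complex.re_add_im c]
    push_cast
    linear_combination (Real.pi * c.im : ℂ) * Complex.I_sq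

end GLTilde

/-- The right action `σ.g = (M⁻¹ ∘ Z_σ, {P_σ(f(φ))})` of `g = (M, f)`. -/
def StabilityCondition.actGL (σ : StabilityCondition T) (g : GLTilde) : StabilityCondition T where
  Z := (planeMap g.M⁻¹).comp σ.Z
  P φ := σ.P (g.f φ)
  P_iso φ := σ.P_iso _
  P_zero φ := σ.P_zero _
  P_biprod φ := σ.P_biprod _
  phase_eq φ E hE h0 := by
    obtain ⟨m, hm, h⟩ := σ.phase_eq _ E hE h0
    obtain ⟨c, hc, h'⟩ := g.compat φ
    refine ⟨m / c, div_pos hm hc, ?_⟩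
    have hc' : (c : ℂ) ≠ 0 := by exact_mod_cast hc.ne'
    have h2 : Complex.exp (Complex.I * Real.pi * g.f φ) =
        ((c⁻¹ : ℝ) : ℂ) * planeMap g.M (Complex.exp (Complex.I * Real.pi * φ)) := by
      rw [h']; push_cast; field_simp
    rw [AddMonoidHom.comp_apply, h, h2, planeMap_real_mul, planeMap_real_mul, ← planeMap_mul,
      g.inv_mul, planeMap_one]
    push_cast
    field_simp
  P_shift φ E := by rw [g.f_add_one]; exact σ.P_shift _ E
  hom_eq_zero φ₁ φ₂ h := σ.hom_eq_zero _ _ (g.f.strictMono h)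
  exists_hn E hE := by
    obtain ⟨H⟩ := σ.exists_hn E hE
    exact ⟨{ n := H.n
             factor := H.factor
             phase := fun i => g.f.symm (H.phase i)
             factor_mem := fun i => by simpa using H.factor_mem i
             factor_ne_zero := H.factor_ne_zero
             phase_strictAnti := g.f.symm.strictMono.comp_strictAnti H.phase_strictAnti
             tower := H.tower }⟩
  support := by
    obtain ⟨N, hN, C, hC, h⟩ := σ.support
    refine ⟨N, hN, C * (|g.M 0 0| + |g.M 0 1| + |g.M 1 0| + |g.M 1 1| + 1), by positivity,
      fun φ E hE h0 => (h _ E hE h0).trans_le ?_⟩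
    rw [mul_assoc]
    refine mul_le_mul_of_nonneg_left ?_ hC.le
    have := norm_planeMap_le g.M (planeMap g.M⁻¹ (σ.Z (K0.cls E)))
    rw [← planeMap_mul, g.mul_inv, planeMap_one] at this
    rw [AddMonoidHom.comp_apply, add_mul]
    exact this.trans (le_add_of_nonneg_right (by positivity))

/-- The right action `σ.λ = (exp(-iπλ) Z_σ, {P_σ(φ + Re λ)})` of `λ ∈ ℂ`. -/
def StabilityCondition.actC (σ : StabilityCondition T) (c : ℂ) : StabilityCondition T :=
  σ.actGL (GLTilde.ofComplex c)

/-- The quotient metric of `d_B` by the action of `ℂ`, on representatives. -/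
def StabilityCondition.dBbar (σ τ : StabilityCondition T) : ENNReal :=
  ⨅ c : ℂ, dB σ (τ.actC c)

/-! ### The action of autoequivalences -/

lemma IsTower.map (F : T ⥤ T) [F.CommShift ℤ] [F.IsTriangulated] {p : ℕ} {A : Fin p → T} {E : T}
    (h : IsTower A E) : IsTower (fun i => F.obj (A i)) (F.obj E) := by
  obtain ⟨X, h0, ⟨e⟩, ht⟩ := h
  refine ⟨fun i => F.obj (X i), F.map_isZero h0, ⟨F.mapIso e⟩, fun i => ?_⟩
  obtain ⟨f, g, h, hd⟩ := ht i
  exact ⟨_, _, _, F.map_distinguished _ hd⟩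

lemma IsTower.of_iso {p : ℕ} {A : Fin p → T} {E E' : T} (h : IsTower A E) (e : E ≅ E') :
    IsTower A E' := by
  obtain ⟨X, h0, ⟨e'⟩, ht⟩ := h
  exact ⟨X, h0, ⟨e' ≪≫ e⟩, ht⟩

section Aut

variable (F : T ≌ T) [F.functor.CommShift ℤ] [F.functor.IsTriangulated]

/-- The homomorphism of Grothendieck groups induced by the inverse of an exact autoequivalence. -/
def K0.mapInv : K0 T →+ K0 T :=
  letI : F.inverse.CommShift ℤ := F.commShiftInverse ℤ
  haveI : F.CommShift ℤ := F.commShift_of_functor ℤ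
  haveI : F.inverse.IsTriangulated := F.toAdjunction.isTriangulated_rightAdjoint
  K0.map F.inverse

lemma K0.mapInv_cls (E : T) : K0.mapInv F (K0.cls E) = K0.cls (F.inverse.obj E) := by
  simp [K0.mapInv]

lemma K0.map_mapInv (x : K0 T) : K0.map F.functor (K0.mapInv F x) = x := by
  have : (K0.map F.functor).comp (K0.mapInv F) = AddMonoidHom.id (K0 T) :=
    K0.hom_ext fun E => by
      simp only [AddMonoidHom.comp_apply, K0.mapInv_cls, K0.map_cls, AddMonoidHom.id_apply]
      exact K0.cls_iso (F.counitIso.app E)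
  exact DFunLike.congr_fun this x

/-- The left action `F.σ = (Z_σ ∘ K(F⁻¹), {F(P_σ(φ))})` of an exact autoequivalence `F`; here `E`
lies in the essential image of `P_σ(φ)` iff `F⁻¹ E` lies in `P_σ(φ)`. -/
def StabilityCondition.actAut (σ : StabilityCondition T) : StabilityCondition T where
  Z := σ.Z.comp (K0.mapInv F)
  P φ := fun E => σ.P φ (F.inverse.obj E)
  P_iso φ _ _ e h := σ.P_iso φ (F.inverse.mapIso e) h
  P_zero φ _ h := σ.P_zero φ (F.inverse.map_isZero h)
  P_biprod φ E E' h h' := by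
    have : F.inverse.Additive := F.inverse_additive
    have := preservesBinaryBiproducts_of_preservesBiproducts F.inverse
    exact σ.P_iso φ (F.inverse.mapBiprod E E').symm (σ.P_biprod φ h h')
  phase_eq φ E hE h0 := by
    rw [AddMonoidHom.comp_apply, K0.mapInv_cls]
    exact σ.phase_eq φ _ hE fun h => h0 ((F.functor.map_isZero h).of_iso (F.counitIso.app E).symm)
  P_shift φ E := by
    let : F.inverse.CommShift ℤ := F.commShiftInverse ℤ
    rw [σ.P_shift]
    constructor
    · rintro ⟨E', h, ⟨e⟩⟩
      exact ⟨F.functor.obj E', σ.P_iso φ (F.unitIso.app E') h,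
        ⟨(F.counitIso.app E).symm ≪≫ F.functor.mapIso e ≪≫ (F.functor.commShiftIso (1 : ℤ)).app E'⟩⟩
    · rintro ⟨E', h, ⟨e⟩⟩
      exact ⟨F.inverse.obj E', h,
        ⟨F.inverse.mapIso e ≪≫ (F.inverse.commShiftIso (1 : ℤ)).app E'⟩⟩
  hom_eq_zero φ₁ φ₂ h E₁ E₂ h₁ h₂ f :=
    F.inverse.map_injective (by rw [σ.hom_eq_zero _ _ h _ _ h₁ h₂ (F.inverse.map f),
      F.inverse.map_zero])
  exists_hn E hE := by
    obtain ⟨H⟩ := σ.exists_hn (F.inverse.obj E)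
      fun h => hE ((F.functor.map_isZero h).of_iso (F.counitIso.app E).symm)
    exact ⟨{ n := H.n
             factor := fun i => F.functor.obj (H.factor i)
             phase := H.phase
             factor_mem := fun i => σ.P_iso _ (F.unitIso.app _) (H.factor_mem i)
             factor_ne_zero := fun i h => H.factor_ne_zero i
               ((F.inverse.map_isZero h).of_iso (F.unitIso.app _))
             phase_strictAnti := H.phase_strictAnti
             tower := (H.tower.map F.functor).of_iso (F.counitIso.app E) }⟩
  support := by
    obtain ⟨N, hN, C, hC, h⟩ := σ.support
    refine ⟨N.comp ((K0.mapInv F).toIntLinearMap.baseChange ℝ), fun x hx => ?_, C, hC,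
      fun φ E hE h0 => ?_⟩
    · have h1 : (K0.mapInv F).toIntLinearMap.baseChange ℝ x = 0 := hN _ hx
      have h2 : (K0.map F.functor).toIntLinearMap.baseChange ℝ
          ((K0.mapInv F).toIntLinearMap.baseChange ℝ x) = x := by
        rw [← LinearMap.comp_apply, ← LinearMap.baseChange_comp]
        have : (K0.map F.functor).toIntLinearMap ∘ₗ (K0.mapInv F).toIntLinearMap =
            LinearMap.id := LinearMap.ext fun y => K0.map_mapInv F y
        rw [this, LinearMap.baseChange_id, LinearMap.id_apply]
      rw [← h2, h1, map_zero]
    · have := h φ _ hE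
        fun h => h0 ((F.functor.map_isZero h).of_iso (F.counitIso.app E).symm)
      simpa [K0.mapInv_cls] using this

/-- The translation length of `F` on `S / ℂ` with respect to the quotient metric, where `S` is an
`F`-stable set of stability conditions. -/
def translationLength (S : Set (StabilityCondition T)) : ENNReal :=
  ⨅ σ ∈ S, StabilityCondition.dBbar σ (σ.actAut F)

/-- The data exhibiting `F` as a pseudo-Anosov functor with respect to a connected component `S` of
the space of stability conditions. -/
structure PseudoAnosov (S : Set (StabilityCondition T)) where
  σ : StabilityCondition T
  g : GLTilde
  r : ℝ
  mem : σ ∈ S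
  one_lt : 1 < |r|
  M_eq : g.M = !![1 / r, 0; 0, r] ∨ g.M = !![r, 0; 0, 1 / r]
  act_eq : σ.actAut F = σ.actGL g

end Aut

/-- The stretch factor `ρ_F = |r|`. -/
def PseudoAnosov.stretchFactor {F : T ≌ T} [F.functor.CommShift ℤ] [F.functor.IsTriangulated]
    {S : Set (StabilityCondition T)} (h : PseudoAnosov F S) : ℝ := |h.r|

/-! ### Entropy -/

/-- A split generator: the smallest triangulated subcategory which is closed under
direct summands and contains `G` is the whole category. -/
def IsSplitGenerator (G : T) : Prop :=
  (ObjectProperty.singleton G).IsClassicalTriangulatedGenerator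

/-- The complexity `δ(G, E)`: the least `p > 0` such that `E ⊞ M`, for some `M`, is the end of a
tower of `p` exact triangles with cones `G[n₁], …, G[n_p]`. (Such a `p` exists if `G` is a split
generator.) -/
def complexity (G E : T) : ℕ :=
  sInf {p : ℕ | 0 < p ∧ ∃ (M : T) (n : Fin p → ℤ), IsTower (fun i => G⟦n i⟧) (E ⊞ M)}

/-- `h` is the entropy of `F`: split generators exist, and for each split generator `G` the limit
of `(1 / n) log δ(G, Fⁿ G)` exists and equals `h`. -/
def HasEntropy (F : T ⥤ T) (h : ℝ) : Prop :=
  (∃ G : T, IsSplitGenerator G) ∧ ∀ G : T, IsSplitGenerator G →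
    Filter.Tendsto (fun n : ℕ => (1 / (n : ℝ)) * Real.log (complexity G (F.obj^[n] G)))
      Filter.atTop (nhds h)

end General

/-! ### Quivers -/

section Quivers

variable (Q : Type u) [Quiver.{v} Q]

/-- The underlying graph of the quiver is connected (and nonempty). -/
def IsConnectedQuiver : Prop :=
  Nonempty Q ∧ Subsingleton (Quiver.WeaklyConnectedComponent Q)

/-- There are no oriented cycles. -/
def IsAcyclicQuiver : Prop := ∀ (a : Q) (p : Quiver.Path a a), p = Quiver.Path.nil

/-- The category of finite dimensional complex representations of `Q`, i.e. functors from the free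
category on `Q` to finite dimensional vector spaces. For a finite acyclic quiver this is the
category of finitely generated modules over the path algebra `ℂQ`. -/
abbrev RepFD := Paths Q ⥤ FGModuleCat.{0} ℂ

variable [HasDerivedCategory.{w} (RepFD Q)]

/-- The bounded derived category of finite dimensional representations of `Q`. -/
abbrev DbQuiver := (DerivedCategory.TStructure.t (C := RepFD Q)).bounded.FullSubcategory

/-- The standard heart of the bounded derived category: complexes with cohomology concentrated in
degree `0`. -/
def standardHeart : ObjectProperty (DbQuiver Q) :=
  (DerivedCategory.TStructure.t (C := RepFD Q)).onBounded.heart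

/-- The distinguished connected component of the space of stability conditions: the one containing
the (connected) set of all stability conditions with heart the representations of `Q`. -/
def distinguishedComponent : Set (StabilityCondition (DbQuiver Q)) :=
  {σ | ∃ τ : StabilityCondition (DbQuiver Q), τ.heart = standardHeart Q ∧
    σ ∈ connectedComponent τ}

end Quivers

end

end StabMetric

namespace StabMetric

noncomputable section

/-! ### Towers of exact triangles and their classes in the Grothendieck group. -/

section Towers

variable {T : Type u} [Category.{v} T] [HasZeroObject T] [HasShift T ℤ] [Preadditive T]
  [∀ n : ℤ, (shiftFunctor T n).Additive] [Pretriangulated T]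

/-! The proof compares three sizes of an object `E`: its mass for a stability condition in the
distinguished component, the total dimension `totalDim E` of its cohomology, and its complexity with
respect to a split generator `G`. All three agree up to multiplicative constants, so under iteration
of `F` they have the same exponential growth rate, which is computed at `σ_F`.

Mass versus dimension: let `τ` have the standard heart. Its semistable objects are shifted
representations, and a representation of dimension `n` is an `n`-fold extension of vertex simples.
The finitely many central charges of these simples lie in a half plane, so no cancellation occurs
and `‖Z‖` is comparable to `n`. The total dimension is additive along Harder–Narasimhan towers,
because the shifts decrease (`exists_mass_bounds_of_heart`). Points of one connected component are
at finite distance, so the comparison spreads to the whole component (`exists_mass_bounds_of_mem`).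

Complexity versus dimension: subadditivity gives `totalDim E ≤ p * totalDim G` for `E` of cost `p`.
Conversely `E` is built from `totalDim E` shifted simples, each of bounded cost
(`exists_totalDim_eq_and_hasCost`).

Growth at `σ_F`: `F` permutes the semistable objects and acts on their central charges by the matrix
`M`, so the mass of `Fⁿ E` is the sum of the `‖Mⁿ Z(A_i)‖` over the factors of `E`, hence at most
`ρⁿ` times the mass of `E`. By the support property and finite generation of `K₀`, central charges
of semistable objects stay away from zero. So `Mⁿ Z(A_i)` cannot tend to zero, its expanding
coordinate is nonzero, and the growth is exactly of order `ρⁿ` (`Equivariant.exists_mass_bounds`).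
The same holds for the inverse of `F`. This gives the entropy.

Translation length: at `σ_F`, after an integer rotation, `g_F` moves phases and logarithms of masses
by at most `log ρ` (`dBbar_actGL_le`). For the lower bound, scaling by `λ` adds a drift `π Im λ` to
the growth of log masses under `F` and the opposite drift under the inverse. Averaging the two
cancels the drift (`le_dBbar_actAut`). -/

lemma distinguished_of_isos {X Y Z X' Y' Z' : T} {f : X ⟶ Y} {g : Y ⟶ Z} {h : Z ⟶ X⟦(1 : ℤ)⟧}
    (hd : Triangle.mk f g h ∈ (distTriang T)) {f' : X' ⟶ Y'} {g' : Y' ⟶ Z'}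
    {h' : Z' ⟶ X'⟦(1 : ℤ)⟧} (e₁ : X' ≅ X) (e₂ : Y' ≅ Y) (e₃ : Z' ≅ Z)
    (h₁ : f' ≫ e₂.hom = e₁.hom ≫ f) (h₂ : g' ≫ e₃.hom = e₂.hom ≫ g)
    (h₃ : h' ≫ e₁.hom⟦(1 : ℤ)⟧' = e₃.hom ≫ h) :
    Triangle.mk f' g' h' ∈ (distTriang T) :=
  isomorphic_distinguished _ hd _ (Triangle.isoMk _ _ e₁ e₂ e₃ h₁ h₂ h₃)

lemma exists_eq_comp_of_distinguished₂ {X Y Z W : T} {f : X ⟶ Y} {g : Y ⟶ Z}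
    {h : Z ⟶ X⟦(1 : ℤ)⟧} (hd : Triangle.mk f g h ∈ (distTriang T)) (k : Y ⟶ W) (hk : f ≫ k = 0) :
    ∃ l : Z ⟶ W, k = g ≫ l :=
  Triangle.yoneda_exact₂ _ hd k hk

lemma exists_eq_comp_of_distinguished₃ {X Y Z W : T} {f : X ⟶ Y} {g : Y ⟶ Z}
    {h : Z ⟶ X⟦(1 : ℤ)⟧} (hd : Triangle.mk f g h ∈ (distTriang T)) (k : Z ⟶ W) (hk : g ≫ k = 0) :
    ∃ l : X⟦(1 : ℤ)⟧ ⟶ W, k = h ≫ l :=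
  Triangle.yoneda_exact₃ _ hd k hk

lemma isTower_zero_iff (A : Fin 0 → T) (E : T) : IsTower A E ↔ IsZero E := by
  constructor
  · rintro ⟨X, h0, ⟨e⟩, -⟩
    exact h0.of_iso e.symm
  · intro h
    exact ⟨fun _ => E, h, ⟨Iso.refl _⟩, fun i => i.elim0⟩

/-- Recursive form of the definition: the inductions on towers split off the last triangle through
it. -/
lemma isTower_succ_iff {p : ℕ} (A : Fin (p + 1) → T) (E : T) :
    IsTower A E ↔ ∃ (X : T) (f : X ⟶ E) (g : E ⟶ A (Fin.last p))
      (h : A (Fin.last p) ⟶ X⟦(1 : ℤ)⟧), IsTower (fun i => A i.castSucc) X ∧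
        Triangle.mk f g h ∈ (distTriang T) := by
  constructor
  · rintro ⟨X, h0, ⟨e⟩, ht⟩
    obtain ⟨f, g, h, hd⟩ := ht (Fin.last p)
    refine ⟨X (Fin.last p).castSucc, f ≫ e.hom, e.inv ≫ g, h,
      ⟨fun i => X i.castSucc, h0, ⟨Iso.refl _⟩, fun i => ht i.castSucc⟩, ?_⟩
    exact distinguished_of_isos hd (Iso.refl _) e.symm (Iso.refl _) (by simp) (by simp) (by simp)
  · rintro ⟨Y, f, g, h, ⟨X, h0, ⟨e⟩, ht⟩, hd⟩
    let X' : Fin (p + 2) → T := fun i => Fin.lastCases (motive := fun _ => T) E X i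
    have hc : ∀ i : Fin (p + 1), X' i.castSucc = X i := fun i => by simp [X']
    have hl : X' (Fin.last (p + 1)) = E := by simp [X']
    refine ⟨X', ?_, ⟨eqToIso hl⟩, fun i => ?_⟩
    · have := hc 0
      rw [Fin.castSucc_zero] at this
      rwa [this]
    · induction i using Fin.lastCases with
      | last =>
        rw [hc, Fin.succ_last, hl]
        refine ⟨e.hom ≫ f, g, h ≫ e.inv⟦(1 : ℤ)⟧', ?_⟩
        exact distinguished_of_isos hd e (Iso.refl _) (Iso.refl _) (by simp) (by simp)
          (by simp [← Functor.map_comp])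
      | cast i =>
        rw [hc, Fin.succ_castSucc, hc]
        exact ht i

lemma IsTower.shift {p : ℕ} {A : Fin p → T} {E : T} (h : IsTower A E) (n : ℤ) :
    IsTower (fun i => (A i)⟦n⟧) (E⟦n⟧) := by
  obtain ⟨X, h0, ⟨e⟩, ht⟩ := h
  refine ⟨fun i => (X i)⟦n⟧, (shiftFunctor T n).map_isZero h0, ⟨(shiftFunctor T n).mapIso e⟩,
    fun i => ?_⟩
  obtain ⟨f, g, h, hd⟩ := ht i
  exact ⟨_, _, _, Triangle.shift_distinguished _ hd n⟩

/-- A morphism vanishing on the previous stage factors through the last cone. -/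
lemma IsTower.hom_eq_zero {p : ℕ} {A : Fin p → T} {E Y : T} (h : IsTower A E)
    (hA : ∀ i (f : A i ⟶ Y), f = 0) (f : E ⟶ Y) : f = 0 := by
  induction p generalizing E with
  | zero => exact ((isTower_zero_iff _ _).1 h).eq_of_src _ _
  | succ p ih =>
    obtain ⟨X, a, b, c, hX, hd⟩ := (isTower_succ_iff _ _).1 h
    obtain ⟨g, hg⟩ := exists_eq_comp_of_distinguished₂ hd f (ih hX (fun i => hA _) _)
    rw [hg, hA _ g, comp_zero]

lemma isTower_one {A : Fin 1 → T} {E : T} (e : A 0 ≅ E) : IsTower A E := by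
  rw [isTower_succ_iff]
  obtain ⟨Z, hZ⟩ := HasZeroObject.zero (C := T)
  refine ⟨Z, 0, e.inv, 0, (isTower_zero_iff _ _).2 hZ, ?_⟩
  rw [Triangle.distinguished_iff_of_isZero₁ _ hZ]
  exact inferInstanceAs (IsIso e.inv)

lemma IsTower.of_factor_iso {p : ℕ} {A B : Fin p → T} {E : T} (h : IsTower A E)
    (e : ∀ i, A i ≅ B i) : IsTower B E := by
  obtain ⟨X, h0, h1, ht⟩ := h
  refine ⟨X, h0, h1, fun i => ?_⟩
  obtain ⟨f, g, h, hd⟩ := ht i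
  exact ⟨f, g ≫ (e i).hom, (e i).inv ≫ h, distinguished_of_isos hd
    (Iso.refl _) (Iso.refl _) (e i).symm (by simp) (by simp) (by simp)⟩

lemma K0.cls_eq_add {X Y Z : T} {f : X ⟶ Y} {g : Y ⟶ Z} {h : Z ⟶ X⟦(1 : ℤ)⟧}
    (hd : Triangle.mk f g h ∈ (distTriang T)) : K0.cls Y = K0.cls X + K0.cls Z := by
  have h := K0.cls_triangle (Triangle.mk f g h) hd
  simp only [Triangle.mk_obj₁, Triangle.mk_obj₂, Triangle.mk_obj₃] at h
  rw [sub_add_eq_add_sub, sub_eq_zero] at h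
  exact h.symm

lemma K0.cls_isZero {E : T} (h : IsZero E) : K0.cls E = 0 := by
  have hd : Triangle.mk (0 : E ⟶ E) (0 : E ⟶ E) 0 ∈ (distTriang T) :=
    (Triangle.distinguished_iff_of_isZero₁ _ h).2 ⟨0, h.eq_of_src _ _, h.eq_of_src _ _⟩
  have := K0.cls_eq_add hd
  rwa [left_eq_add] at this

lemma K0.cls_shift_one (E : T) : K0.cls (E⟦(1 : ℤ)⟧) = -K0.cls E := by
  have h := K0.cls_eq_add (contractible_distinguished₂ E)
  rw [K0.cls_isZero (isZero_zero T)] at h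
  exact (neg_eq_of_add_eq_zero_right h.symm).symm

lemma IsTower.cls_eq {p : ℕ} {A : Fin p → T} {E : T} (h : IsTower A E) :
    K0.cls E = ∑ i, K0.cls (A i) := by
  induction p generalizing E with
  | zero => simpa using K0.cls_isZero ((isTower_zero_iff _ _).1 h)
  | succ p ih =>
    obtain ⟨X, a, b, c, hX, hd⟩ := (isTower_succ_iff _ _).1 h
    rw [Fin.sum_univ_castSucc, ← ih hX, K0.cls_eq_add hd]

end Towers

/-! ### Uniqueness of Harder–Narasimhan filtrations. -/

section HN

variable {T : Type u} [Category.{v} T] [HasZeroObject T] [HasShift T ℤ] [Preadditive T]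
  [∀ n : ℤ, (shiftFunctor T n).Additive] [Pretriangulated T]

namespace StabilityCondition

variable (σ : StabilityCondition T)

lemma P_shift_one {φ : ℝ} {E : T} (h : σ.P φ E) : σ.P (φ + 1) (E⟦(1 : ℤ)⟧) :=
  (σ.P_shift φ _).2 ⟨E, h, ⟨Iso.refl _⟩⟩

/-- If the projection to the last factor were zero, the identity of that factor would factor through
`X⟦1⟧`, whose factors have strictly larger phases; the factor would then be zero. -/
lemma exists_hom_last_ne_zero {p : ℕ} {A : Fin (p + 1) → T} {φ : Fin (p + 1) → ℝ}
    (hφ : StrictAnti φ) (hA : ∀ i, σ.P (φ i) (A i)) (hA0 : ∀ i, ¬ IsZero (A i)) {E : T}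
    (hAE : IsTower A E) : ∃ b : E ⟶ A (Fin.last p), b ≠ 0 := by
  obtain ⟨X, a, b, c, hX, hd⟩ := (isTower_succ_iff _ _).1 hAE
  refine ⟨b, fun hb => hA0 (Fin.last p) ((IsZero.iff_id_eq_zero _).2 ?_)⟩
  obtain ⟨g, hg⟩ := exists_eq_comp_of_distinguished₃ hd (𝟙 (A (Fin.last p))) (by
    rw [hb, zero_comp])
  have : g = 0 := (hX.shift 1).hom_eq_zero (fun i f => σ.hom_eq_zero (φ i.castSucc + 1) _
    (by have := hφ.antitone (Fin.le_last i.castSucc); linarith) _ _ (σ.P_shift_one (hA _)) (hA _) f)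
      g
  rw [this, comp_zero] at hg
  exact hg

lemma not_isZero_of_isTower {p : ℕ} {A : Fin (p + 1) → T} {φ : Fin (p + 1) → ℝ}
    (hφ : StrictAnti φ) (hA : ∀ i, σ.P (φ i) (A i)) (hA0 : ∀ i, ¬ IsZero (A i)) {E : T}
    (hAE : IsTower A E) : ¬ IsZero E := fun hE => by
  obtain ⟨b, hb⟩ := σ.exists_hom_last_ne_zero hφ hA hA0 hAE
  exact hb (hE.eq_of_src _ _)

/-- Otherwise all factors `B i` have phase above that of the last `A`, which kills the nonzero
projection from `E` to it. -/
lemma tower_last_phase_le {p q : ℕ} {A : Fin (p + 1) → T} {B : Fin (q + 1) → T}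
    {φ : Fin (p + 1) → ℝ} {ψ : Fin (q + 1) → ℝ} (hφ : StrictAnti φ) (hψ : StrictAnti ψ)
    (hA : ∀ i, σ.P (φ i) (A i)) (hB : ∀ i, σ.P (ψ i) (B i))
    (hA0 : ∀ i, ¬ IsZero (A i)) {E : T} (hAE : IsTower A E) (hBE : IsTower B E) :
    ψ (Fin.last q) ≤ φ (Fin.last p) := by
  by_contra! hlt
  obtain ⟨b, hb⟩ := σ.exists_hom_last_ne_zero hφ hA hA0 hAE
  exact hb (hBE.hom_eq_zero (fun i f => σ.hom_eq_zero (ψ i) _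
    (hlt.trans_le (hψ.antitone (Fin.le_last i))) _ _ (hB i) (hA _) f) b)

/-- Vanishing of maps from `X` to the last `B` and from `Y` to the last `A` makes the two
projections from `E` factor through each other. Vanishing of maps from `X⟦1⟧` and `Y⟦1⟧` makes such
factorizations unique, so they are mutually inverse. The resulting isomorphism of `X` and `Y` drives
the induction for uniqueness. -/
lemma tower_last_iso {p q : ℕ} {A : Fin (p + 1) → T} {B : Fin (q + 1) → T}
    {φ : Fin (p + 1) → ℝ} {ψ : Fin (q + 1) → ℝ} (hφ : StrictAnti φ) (hψ : StrictAnti ψ)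
    (hA : ∀ i, σ.P (φ i) (A i)) (hB : ∀ i, σ.P (ψ i) (B i))
    (hlast : φ (Fin.last p) = ψ (Fin.last q)) {E X Y : T}
    {a : X ⟶ E} {b : E ⟶ A (Fin.last p)} {c : A (Fin.last p) ⟶ X⟦(1 : ℤ)⟧}
    (hX : IsTower (fun i => A i.castSucc) X) (hd : Triangle.mk a b c ∈ (distTriang T))
    {a' : Y ⟶ E} {b' : E ⟶ B (Fin.last q)} {c' : B (Fin.last q) ⟶ Y⟦(1 : ℤ)⟧}
    (hY : IsTower (fun i => B i.castSucc) Y) (hd' : Triangle.mk a' b' c' ∈ (distTriang T)) :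
    Nonempty (A (Fin.last p) ≅ B (Fin.last q)) ∧ Nonempty (X ≅ Y) := by
  have hXB : ∀ f : X ⟶ B (Fin.last q), f = 0 := fun f =>
    hX.hom_eq_zero (fun i f => σ.hom_eq_zero (φ i.castSucc) _
      (by rw [← hlast]; exact hφ (Fin.castSucc_lt_last i)) _ _ (hA _) (hB _) f) f
  have hYA : ∀ f : Y ⟶ A (Fin.last p), f = 0 := fun f =>
    hY.hom_eq_zero (fun i f => σ.hom_eq_zero (ψ i.castSucc) _
      (by rw [hlast]; exact hψ (Fin.castSucc_lt_last i)) _ _ (hB _) (hA _) f) f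
  have hXA : ∀ f : X⟦(1 : ℤ)⟧ ⟶ A (Fin.last p), f = 0 := fun f =>
    (hX.shift 1).hom_eq_zero (fun i f => σ.hom_eq_zero (φ i.castSucc + 1) _
      (by have := hφ.antitone (Fin.le_last i.castSucc); linarith) _ _
        (σ.P_shift_one (hA _)) (hA _) f) f
  have hYB : ∀ f : Y⟦(1 : ℤ)⟧ ⟶ B (Fin.last q), f = 0 := fun f =>
    (hY.shift 1).hom_eq_zero (fun i f => σ.hom_eq_zero (ψ i.castSucc + 1) _
      (by have := hψ.antitone (Fin.le_last i.castSucc); linarith) _ _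
        (σ.P_shift_one (hB _)) (hB _) f) f
  obtain ⟨u, hu⟩ := exists_eq_comp_of_distinguished₂ hd b' (hXB _)
  obtain ⟨u', hu'⟩ := exists_eq_comp_of_distinguished₂ hd' b (hYA _)
  have h1 : u ≫ u' = 𝟙 _ := by
    obtain ⟨g, hg⟩ := exists_eq_comp_of_distinguished₃ hd (u ≫ u' - 𝟙 _)
      (by
        rw [Preadditive.comp_sub, ← Category.assoc, ← hu, ← hu', Category.comp_id, sub_self])
    rw [hXA g, comp_zero] at hg
    exact sub_eq_zero.1 hg
  have h2 : u' ≫ u = 𝟙 _ := by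
    obtain ⟨g, hg⟩ := exists_eq_comp_of_distinguished₃ hd' (u' ≫ u - 𝟙 _)
      (by
        rw [Preadditive.comp_sub, ← Category.assoc, ← hu', ← hu, Category.comp_id, sub_self])
    rw [hYB g, comp_zero] at hg
    exact sub_eq_zero.1 hg
  refine ⟨⟨⟨u, u', h1, h2⟩⟩, ?_⟩
  obtain ⟨s, hs1, hs2⟩ := complete_distinguished_triangle_morphism₁ _ _ hd hd' (𝟙 E) u
    (hu.symm.trans (Category.id_comp _).symm)
  let θ : Triangle.mk a b c ⟶ Triangle.mk a' b' c' :=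
    { hom₁ := s, hom₂ := 𝟙 E, hom₃ := u, comm₁ := hs1, comm₂ := hu.symm.trans (Category.id_comp _).symm, comm₃ := hs2 }
  have : IsIso s := isIso₁_of_isIso₂₃ θ hd hd' (inferInstanceAs (IsIso (𝟙 E)))
    ⟨u', h1, h2⟩
  exact ⟨@asIso _ _ X Y s this⟩

/-- Uniqueness of Harder--Narasimhan towers. -/
lemma tower_unique {p q : ℕ} {A : Fin p → T} {B : Fin q → T}
    {φ : Fin p → ℝ} {ψ : Fin q → ℝ} (hφ : StrictAnti φ) (hψ : StrictAnti ψ)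
    (hA : ∀ i, σ.P (φ i) (A i)) (hB : ∀ i, σ.P (ψ i) (B i))
    (hA0 : ∀ i, ¬ IsZero (A i)) (hB0 : ∀ i, ¬ IsZero (B i)) {E : T}
    (hAE : IsTower A E) (hBE : IsTower B E) :
    ∃ h : p = q, ∀ i, φ i = ψ (i.cast h) ∧ Nonempty (A i ≅ B (i.cast h)) := by
  induction p generalizing q E with
  | zero =>
    cases q with
    | zero => exact ⟨rfl, fun i => i.elim0⟩
    | succ q => exact (σ.not_isZero_of_isTower hψ hB hB0 hBE ((isTower_zero_iff _ _).1 hAE)).elim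
  | succ p ih =>
    cases q with
    | zero => exact (σ.not_isZero_of_isTower hφ hA hA0 hAE ((isTower_zero_iff _ _).1 hBE)).elim
    | succ q =>
      have hlast := (σ.tower_last_phase_le hψ hφ hB hA hB0 hBE hAE).antisymm
        (σ.tower_last_phase_le hφ hψ hA hB hA0 hAE hBE)
      obtain ⟨X, a, b, c, hX, hd⟩ := (isTower_succ_iff _ _).1 hAE
      obtain ⟨Y, a', b', c', hY, hd'⟩ := (isTower_succ_iff _ _).1 hBE
      obtain ⟨h1, ⟨e⟩⟩ := σ.tower_last_iso hφ hψ hA hB hlast hX hd hY hd'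
      obtain ⟨rfl, H⟩ := ih (hφ.comp_strictMono Fin.strictMono_castSucc)
        (hψ.comp_strictMono Fin.strictMono_castSucc) (fun i => hA _) (fun i => hB _)
        (fun i => hA0 _) (fun i => hB0 _) hX (hY.of_iso e.symm)
      refine ⟨rfl, fun i => ?_⟩
      induction i using Fin.lastCases with
      | last => exact ⟨hlast, h1⟩
      | cast i => exact H i

end StabilityCondition

end HN

lemma not_isZero_functor_obj {C : Type u} [Category.{v} C] [HasZeroMorphisms C] (F : C ≌ C) {E : C}
    (h : ¬ IsZero E) : ¬ IsZero (F.functor.obj E) := fun h' =>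
  h (have := (Functor.preservesZeroMorphisms_of_isLeftAdjoint F.inverse)
    (F.inverse.map_isZero h').of_iso (F.unitIso.app E))

lemma not_isZero_inverse_obj {C : Type u} [Category.{v} C] [HasZeroMorphisms C] (F : C ≌ C) {E : C}
    (h : ¬ IsZero E) : ¬ IsZero (F.inverse.obj E) :=
  not_isZero_functor_obj F.symm h

/-! ### Masses and phases under the group actions; functors preserving semistability. -/

section Actions

variable {T : Type u} [Category.{v} T] [HasZeroObject T] [HasShift T ℤ] [Preadditive T]
  [∀ n : ℤ, (shiftFunctor T n).Additive] [Pretriangulated T]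

lemma K0.cls_inverse_functor (F : T ≌ T) (E : T) :
    K0.cls (F.inverse.obj (F.functor.obj E)) = K0.cls E :=
  K0.cls_iso (F.unitIso.app E).symm

namespace StabilityCondition

variable (σ : StabilityCondition T)

/-- The filtration `σ.hn` is an arbitrary choice; this allows masses and phases to be read off from
any filtration at hand. -/
lemma hn_unique (E : {E : T // ¬ IsZero E}) (H : HNFiltration σ.P E.1) :
    ∃ h : (σ.hn E).n + 1 = H.n + 1, ∀ i, (σ.hn E).phase i = H.phase (i.cast h) ∧
      Nonempty ((σ.hn E).factor i ≅ H.factor (i.cast h)) :=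
  σ.tower_unique (σ.hn E).phase_strictAnti H.phase_strictAnti (σ.hn E).factor_mem H.factor_mem
    (σ.hn E).factor_ne_zero H.factor_ne_zero (σ.hn E).tower H.tower

lemma mass_eq (E : {E : T // ¬ IsZero E}) (H : HNFiltration σ.P E.1) :
    σ.mass E = ∑ i, ‖σ.Z (K0.cls (H.factor i))‖ := by
  obtain ⟨h, hi⟩ := σ.hn_unique E H
  refine Fintype.sum_equiv (finCongr h) _ _ fun i => ?_
  obtain ⟨e⟩ := (hi i).2
  rw [K0.cls_iso e]
  rfl

lemma phiPlus_eq (E : {E : T // ¬ IsZero E}) (H : HNFiltration σ.P E.1) :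
    σ.phiPlus E = H.phase 0 := by
  obtain ⟨h, hi⟩ := σ.hn_unique E H
  exact (hi 0).1

lemma phiMinus_eq (E : {E : T // ¬ IsZero E}) (H : HNFiltration σ.P E.1) :
    σ.phiMinus E = H.phase (Fin.last _) := by
  obtain ⟨h, hi⟩ := σ.hn_unique E H
  rw [phiMinus, (hi _).1]
  congr 1
  ext
  simp

lemma mass_iso {E E' : {E : T // ¬ IsZero E}} (e : E.1 ≅ E'.1) : σ.mass E = σ.mass E' :=
  σ.mass_eq E
    { n := (σ.hn E').n
      factor := (σ.hn E').factor
      phase := (σ.hn E').phase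
      factor_mem := (σ.hn E').factor_mem
      factor_ne_zero := (σ.hn E').factor_ne_zero
      phase_strictAnti := (σ.hn E').phase_strictAnti
      tower := (σ.hn E').tower.of_iso e.symm }

/-- The Harder--Narasimhan filtration for `σ.g`. -/
def hnActGL (g : GLTilde) (E : {E : T // ¬ IsZero E}) : HNFiltration (σ.actGL g).P E.1 where
  n := (σ.hn E).n
  factor := (σ.hn E).factor
  phase := fun i => g.f.symm ((σ.hn E).phase i)
  factor_mem := fun i => by simpa [actGL] using (σ.hn E).factor_mem i
  factor_ne_zero := (σ.hn E).factor_ne_zero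
  phase_strictAnti := g.f.symm.strictMono.comp_strictAnti (σ.hn E).phase_strictAnti
  tower := (σ.hn E).tower

lemma mass_actGL (g : GLTilde) (E : {E : T // ¬ IsZero E}) :
    (σ.actGL g).mass E = ∑ i, ‖planeMap g.M⁻¹ (σ.Z (K0.cls ((σ.hn E).factor i)))‖ :=
  (σ.actGL g).mass_eq E (σ.hnActGL g E)

lemma phiPlus_actGL (g : GLTilde) (E : {E : T // ¬ IsZero E}) :
    (σ.actGL g).phiPlus E = g.f.symm (σ.phiPlus E) :=
  (σ.actGL g).phiPlus_eq E (σ.hnActGL g E)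

lemma phiMinus_actGL (g : GLTilde) (E : {E : T // ¬ IsZero E}) :
    (σ.actGL g).phiMinus E = g.f.symm (σ.phiMinus E) :=
  (σ.actGL g).phiMinus_eq E (σ.hnActGL g E)

lemma planeMap_ofComplex (c z : ℂ) :
    planeMap (GLTilde.ofComplex c).M z = Complex.exp (Complex.I * Real.pi * c) * z := by
  simp only [planeMap_apply, GLTilde.ofComplex, Complex.ext_iff, Complex.mul_re, Complex.mul_im]
  constructor <;> simp
  · ring
  · ring

lemma norm_planeMap_ofComplex_inv (c z : ℂ) :
    ‖planeMap (GLTilde.ofComplex c).M⁻¹ z‖ = Real.exp (Real.pi * c.im) * ‖z‖ := by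
  have h : Complex.exp (Complex.I * Real.pi * c) * planeMap (GLTilde.ofComplex c).M⁻¹ z = z := by
    rw [← planeMap_ofComplex, ← planeMap_mul, GLTilde.mul_inv, planeMap_one]
  have h2 := congrArg norm h
  rw [norm_mul, Complex.norm_exp] at h2
  have h3 : (Complex.I * Real.pi * c).re = -(Real.pi * c.im) := by simp
  rw [← h2, h3, ← mul_assoc, ← Real.exp_add]
  simp

lemma mass_actC (c : ℂ) (E : {E : T // ¬ IsZero E}) :
    (σ.actC c).mass E = Real.exp (Real.pi * c.im) * σ.mass E := by
  rw [actC, mass_actGL, mass, Finset.mul_sum]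
  exact Finset.sum_congr rfl fun i _ => norm_planeMap_ofComplex_inv _ _

lemma phiPlus_actC (c : ℂ) (E : {E : T // ¬ IsZero E}) :
    (σ.actC c).phiPlus E = σ.phiPlus E - c.re := by
  rw [actC, phiPlus_actGL, OrderIso.symm_apply_eq]
  simp [GLTilde.ofComplex]

lemma phiMinus_actC (c : ℂ) (E : {E : T // ¬ IsZero E}) :
    (σ.actC c).phiMinus E = σ.phiMinus E - c.re := by
  rw [actC, phiMinus_actGL, OrderIso.symm_apply_eq]
  simp [GLTilde.ofComplex]

end StabilityCondition

/-- The functor `Φ` maps semistable objects of phase `φ` to semistable objects of phase `κ φ`,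
and acts on their central charges by `B`. -/
structure StabilityCondition.Equivariant (σ : StabilityCondition T) (Φ : T ⥤ T) (κ : ℝ → ℝ)
    (B : ℂ → ℂ) : Prop where
  strictMono : StrictMono κ
  not_isZero : ∀ E, ¬ IsZero E → ¬ IsZero (Φ.obj E)
  map_mem : ∀ φ E, σ.P φ E → σ.P (κ φ) (Φ.obj E)
  Z_map : ∀ E, σ.Z (K0.cls (Φ.obj E)) = B (σ.Z (K0.cls E))
  isTower : ∀ {p : ℕ} {A : Fin p → T} {E : T}, IsTower A E →
    IsTower (fun i => Φ.obj (A i)) (Φ.obj E)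

namespace StabilityCondition.Equivariant

variable {σ : StabilityCondition T} {Φ : T ⥤ T} {κ : ℝ → ℝ} {B : ℂ → ℂ}

lemma not_isZero_iterate (h : σ.Equivariant Φ κ B) (n : ℕ) {E : T} (hE : ¬ IsZero E) :
    ¬ IsZero (Φ.obj^[n] E) := by
  induction n with
  | zero => exact hE
  | succ n ih => rw [Function.iterate_succ_apply']; exact h.not_isZero _ ih

lemma mem_iterate (h : σ.Equivariant Φ κ B) (n : ℕ) {φ : ℝ} {E : T} (hE : σ.P φ E) :
    σ.P (κ^[n] φ) (Φ.obj^[n] E) := by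
  induction n with
  | zero => exact hE
  | succ n ih => simp only [Function.iterate_succ_apply']; exact h.map_mem _ _ ih

lemma Z_iterate (h : σ.Equivariant Φ κ B) (n : ℕ) (E : T) :
    σ.Z (K0.cls (Φ.obj^[n] E)) = B^[n] (σ.Z (K0.cls E)) := by
  induction n with
  | zero => rfl
  | succ n ih => simp only [Function.iterate_succ_apply']; rw [h.Z_map, ih]

lemma isTower_iterate (h : σ.Equivariant Φ κ B) (n : ℕ) {p : ℕ} {A : Fin p → T} {E : T}
    (hE : IsTower A E) : IsTower (fun i => Φ.obj^[n] (A i)) (Φ.obj^[n] E) := by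
  induction n with
  | zero => exact hE
  | succ n ih => simp only [Function.iterate_succ_apply']; exact h.isTower ih

lemma mass_iterate (h : σ.Equivariant Φ κ B) (n : ℕ) (E : {E : T // ¬ IsZero E}) :
    σ.mass ⟨Φ.obj^[n] E.1, h.not_isZero_iterate n E.2⟩ =
      ∑ i, ‖B^[n] (σ.Z (K0.cls ((σ.hn E).factor i)))‖ := by
  rw [σ.mass_eq ⟨Φ.obj^[n] E.1, h.not_isZero_iterate n E.2⟩
    { n := (σ.hn E).n
      factor := fun i => Φ.obj^[n] ((σ.hn E).factor i)
      phase := fun i => κ^[n] ((σ.hn E).phase i)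
      factor_mem := fun i => h.mem_iterate n ((σ.hn E).factor_mem i)
      factor_ne_zero := fun i => h.not_isZero_iterate n ((σ.hn E).factor_ne_zero i)
      phase_strictAnti := (h.strictMono.iterate n).comp_strictAnti (σ.hn E).phase_strictAnti
      tower := h.isTower_iterate n (σ.hn E).tower }]
  exact Finset.sum_congr rfl fun i _ => by rw [h.Z_iterate]

end StabilityCondition.Equivariant

section Aut

variable (F : T ≌ T) [F.functor.CommShift ℤ] [F.functor.IsTriangulated]
  (σ : StabilityCondition T)

lemma isTower_inverse {p : ℕ} {A : Fin p → T} {E : T} (h : IsTower A E) :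
    IsTower (fun i => F.inverse.obj (A i)) (F.inverse.obj E) := by
  let _ : F.inverse.CommShift ℤ := F.commShiftInverse ℤ
  have : F.CommShift ℤ := F.commShift_of_functor ℤ
  have : F.inverse.IsTriangulated := F.toAdjunction.isTriangulated_rightAdjoint
  exact h.map F.inverse

lemma StabilityCondition.mass_actAut (E : {E : T // ¬ IsZero E}) :
    (σ.actAut F).mass E = σ.mass ⟨F.inverse.obj E.1, not_isZero_inverse_obj F E.2⟩ := by
  have hadd : F.inverse.Additive := F.inverse_additive
  let H := σ.hn ⟨F.inverse.obj E.1, not_isZero_inverse_obj F E.2⟩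
  rw [(σ.actAut F).mass_eq E
    { n := H.n
      factor := fun i => F.functor.obj (H.factor i)
      phase := H.phase
      factor_mem := fun i => σ.P_iso _ (F.unitIso.app _) (H.factor_mem i)
      factor_ne_zero := fun i => not_isZero_functor_obj F (H.factor_ne_zero i)
      phase_strictAnti := H.phase_strictAnti
      tower := (H.tower.map F.functor).of_iso (F.counitIso.app E.1) }]
  refine Finset.sum_congr rfl fun i _ => ?_
  change ‖σ.Z (K0.mapInv F (K0.cls (F.functor.obj (H.factor i))))‖ = _
  rw [K0.mapInv_cls, K0.cls_inverse_functor]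

variable {F σ} {g : GLTilde} (h : σ.actAut F = σ.actGL g)
include h

lemma StabilityCondition.equivariant_inverse :
    σ.Equivariant F.inverse g.f.symm (planeMap g.M⁻¹) where
  strictMono := g.f.symm.strictMono
  not_isZero _ := not_isZero_inverse_obj F
  -- Compare the slices of phase `f⁻¹ φ`: for `F.σ` membership is tested on the inverse image of
  -- `E`, for `σ.g` it means `σ.P φ E`.
  map_mem φ E hE := by
    have h1 : (σ.actAut F).P (g.f.symm φ) E ↔ (σ.actGL g).P (g.f.symm φ) E := by rw [h]
    change σ.P _ _ ↔ σ.P (g.f (g.f.symm φ)) E at h1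
    rw [OrderIso.apply_symm_apply] at h1
    exact h1.2 hE
  Z_map E := by
    have h1 : (σ.actAut F).Z (K0.cls E) = (σ.actGL g).Z (K0.cls E) := by rw [h]
    change σ.Z (K0.mapInv F _) = planeMap g.M⁻¹ _ at h1
    rwa [K0.mapInv_cls] at h1
  isTower := isTower_inverse F

lemma StabilityCondition.equivariant_functor :
    σ.Equivariant F.functor g.f (planeMap g.M) where
  strictMono := g.f.strictMono
  not_isZero _ := not_isZero_functor_obj F
  map_mem φ E hE := by
    have h1 : (σ.actAut F).P φ (F.functor.obj E) ↔ (σ.actGL g).P φ (F.functor.obj E) := by rw [h]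
    exact h1.1 (σ.P_iso _ (F.unitIso.app E) hE)
  Z_map E := by
    have h1 := (equivariant_inverse h).Z_map (F.functor.obj E)
    rw [K0.cls_inverse_functor] at h1
    rw [show σ.Z (K0.cls E) = planeMap g.M⁻¹ (σ.Z (K0.cls (F.functor.obj E))) from h1,
      ← planeMap_mul, GLTilde.mul_inv, planeMap_one]
  isTower hT := hT.map F.functor

end Aut

end Actions

/-! ### Hyperbolic diagonal maps of the plane. -/

section Hyperbolic

/-- The iterates of `B` expand one coordinate by the factor `ρ` and contract the other one. -/
def IsHyperbolic (B : ℂ → ℂ) (ρ : ℝ) : Prop :=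
  ∃ x y : ℂ → ℝ, ∀ (n : ℕ) (z : ℂ), ρ ^ n * |x z| ≤ ‖B^[n] z‖ ∧ ‖B^[n] z‖ ≤ ρ ^ n * ‖z‖ ∧
    ‖B^[n] z‖ ≤ ρ ^ n * |x z| + (ρ⁻¹) ^ n * |y z|

lemma iterate_diagonal {B : ℂ → ℂ} {a b : ℝ} (hB : ∀ z, B z = ⟨a * z.re, b * z.im⟩) (n : ℕ)
    (z : ℂ) : B^[n] z = ⟨a ^ n * z.re, b ^ n * z.im⟩ := by
  induction n with
  | zero => simp
  | succ n ih =>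
    rw [Function.iterate_succ_apply', ih, hB, pow_succ', pow_succ', mul_assoc, mul_assoc]

lemma norm_diagonal_le {a b ρ : ℝ} (ha : |a| ≤ ρ) (hb : |b| ≤ ρ) (z : ℂ) :
    ‖(⟨a * z.re, b * z.im⟩ : ℂ)‖ ≤ ρ * ‖z‖ := by
  have hρ : 0 ≤ ρ := (abs_nonneg a).trans ha
  rw [← abs_of_nonneg (norm_nonneg _), ← abs_of_nonneg (mul_nonneg hρ (norm_nonneg _)),
    ← sq_le_sq, mul_pow, Complex.sq_norm, Complex.sq_norm, Complex.normSq_apply,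
    Complex.normSq_apply]
  have h1 : a ^ 2 ≤ ρ ^ 2 := sq_le_sq' (by linarith [neg_abs_le a]) ((le_abs_self a).trans ha)
  have h2 : b ^ 2 ≤ ρ ^ 2 := sq_le_sq' (by linarith [neg_abs_le b]) ((le_abs_self b).trans hb)
  nlinarith [mul_le_mul_of_nonneg_right h1 (sq_nonneg z.re),
    mul_le_mul_of_nonneg_right h2 (sq_nonneg z.im)]

lemma isHyperbolic_of_diagonal {B : ℂ → ℂ} {a b ρ : ℝ} (hB : ∀ z, B z = ⟨a * z.re, b * z.im⟩)
    (hρ : 1 < ρ) (hab : (|a| = ρ ∧ |b| = ρ⁻¹) ∨ (|a| = ρ⁻¹ ∧ |b| = ρ)) : IsHyperbolic B ρ := by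
  have hinv : ∀ n : ℕ, (ρ⁻¹) ^ n ≤ ρ ^ n := fun n =>
    pow_le_pow_left₀ (by positivity) ((inv_le_one_of_one_le₀ hρ.le).trans hρ.le) n
  rcases hab with ⟨ha, hb⟩ | ⟨ha, hb⟩
  · refine ⟨Complex.re, Complex.im, fun n z => ⟨?_, ?_, ?_⟩⟩
    · rw [iterate_diagonal hB, ← ha, ← abs_pow, ← abs_mul]
      exact Complex.abs_re_le_norm ⟨a ^ n * z.re, b ^ n * z.im⟩
    · rw [iterate_diagonal hB]
      exact norm_diagonal_le (by rw [abs_pow, ha]) (by rw [abs_pow, hb]; exact hinv n) z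
    · rw [← hb, iterate_diagonal hB, ← ha, ← abs_pow, ← abs_pow, ← abs_mul, ← abs_mul]
      exact Complex.norm_le_abs_re_add_abs_im _
  · refine ⟨Complex.im, Complex.re, fun n z => ⟨?_, ?_, ?_⟩⟩
    · rw [iterate_diagonal hB, ← hb, ← abs_pow, ← abs_mul]
      exact Complex.abs_im_le_norm ⟨a ^ n * z.re, b ^ n * z.im⟩
    · rw [iterate_diagonal hB]
      exact norm_diagonal_le (by rw [abs_pow, ha]; exact hinv n) (by rw [abs_pow, hb]) z
    · rw [← ha, iterate_diagonal hB, ← hb, ← abs_pow, ← abs_pow, ← abs_mul, ← abs_mul, add_comm]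
      exact Complex.norm_le_abs_re_add_abs_im _

/-- If the expanding coordinate of `z` vanished, its orbit would tend to zero, against the lower
bound `ε`. -/
lemma IsHyperbolic.exists_bounds {B : ℂ → ℂ} {ρ : ℝ} (h : IsHyperbolic B ρ) (hρ : 1 < ρ) {z : ℂ}
    {ε : ℝ} (hε : 0 < ε) (hz : ∀ n, ε ≤ ‖B^[n] z‖) : ∃ c : ℝ, 0 < c ∧
      ∀ n : ℕ, c * ρ ^ n ≤ ‖B^[n] z‖ := by
  obtain ⟨x, y, hxy⟩ := h
  refine ⟨|x z|, ?_, fun n => by rw [mul_comm]; exact (hxy n z).1⟩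
  rw [abs_pos]
  intro hx
  have ht : Filter.Tendsto (fun n : ℕ => (ρ⁻¹) ^ n * |y z|) Filter.atTop (nhds (0 * |y z|)) :=
    (tendsto_pow_atTop_nhds_zero_of_lt_one (by positivity) (inv_lt_one_of_one_lt₀ hρ)).mul_const _
  rw [zero_mul] at ht
  obtain ⟨n, hn⟩ := (ht.eventually (gt_mem_nhds hε)).exists
  have := (hz n).trans (hxy n z).2.2
  rw [hx, abs_zero, mul_zero, zero_add] at this
  exact absurd this (not_le.2 hn)

end Hyperbolic

/-! ### How far a diagonal matrix of determinant one can move phases. -/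

section Phase

lemma sinh_le_two_mul {s : ℝ} (h0 : 0 ≤ s) (h1 : s ≤ 1) : Real.sinh s ≤ 2 * s := by
  have h2 := Real.abs_exp_sub_one_le (x := s) (by rwa [abs_of_nonneg h0])
  have h3 := Real.abs_exp_sub_one_le (x := -s) (by rwa [abs_neg, abs_of_nonneg h0])
  rw [abs_neg, abs_of_nonneg h0] at h3
  rw [abs_of_nonneg h0] at h2
  rw [Real.sinh_eq]
  linarith [(abs_le.1 h2).2, (abs_le.1 h3).1]

/-- The hypotheses put `D` in `(-1/2, 1/2)` and say `|tan (πD)| ≤ sinh s`. For `s ≥ 1/2` nothing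
remains to prove; otherwise `π|D| ≤ |tan (πD)| ≤ sinh s ≤ 2s`, and `2 < π`. -/
lemma abs_le_of_abs_sin_le {D s : ℝ} (hD : |D| < 1) (hs : 0 ≤ s)
    (hcos : 0 < Real.cos (Real.pi * D))
    (hsin : |Real.sin (Real.pi * D)| ≤ Real.sinh s * Real.cos (Real.pi * D)) : |D| ≤ s := by
  wlog h0 : 0 ≤ D generalizing D
  · rw [← abs_neg]
    refine this (by rwa [abs_neg]) ?_ ?_ (by linarith)
    · rwa [mul_neg, Real.cos_neg]
    · rwa [mul_neg, Real.cos_neg, Real.sin_neg, abs_neg]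
  rw [abs_of_nonneg h0] at hD ⊢
  have hπ := Real.pi_gt_three
  have hlt : Real.pi * D < Real.pi / 2 := by
    by_contra! hle
    exact absurd hcos (not_lt.2 (Real.cos_nonpos_of_pi_div_two_le_of_le hle (by nlinarith)))
  have hhalf : D < 1 / 2 := by nlinarith
  rcases le_or_gt (1 / 2) s with h | h
  · linarith
  have htan : Real.pi * D ≤ Real.tan (Real.pi * D) := Real.le_tan (by positivity) hlt
  have htan2 : Real.tan (Real.pi * D) ≤ Real.sinh s := by
    rw [Real.tan_eq_sin_div_cos, div_le_iff₀ hcos]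
    exact (le_abs_self _).trans hsin
  have := sinh_le_two_mul hs (by linarith)
  nlinarith

lemma GLTilde.f_add_int (g : GLTilde) (φ : ℝ) (n : ℤ) : g.f (φ + n) = g.f φ + n := by
  induction n with
  | zero => simp
  | succ n ih =>
    have := g.f_add_one (φ + n)
    push_cast at ih ⊢
    rw [← add_assoc, this, ih, add_assoc]
  | pred n ih =>
    have := g.f_add_one (φ + (-n - 1))
    push_cast at ih ⊢
    rw [show φ + (-n - 1) + 1 = φ + -(n : ℝ) by ring, ih] at this
    linarith

lemma GLTilde.exists_trig (g : GLTilde) {a b : ℝ} (hM : g.M = !![a, 0; 0, b]) (φ : ℝ) :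
    ∃ c : ℝ, 0 < c ∧ a * Real.cos (Real.pi * φ) = c * Real.cos (Real.pi * g.f φ) ∧
      b * Real.sin (Real.pi * φ) = c * Real.sin (Real.pi * g.f φ) := by
  obtain ⟨c, hc, h⟩ := g.compat φ
  refine ⟨c, hc, ?_⟩
  have e : ∀ x : ℝ, Complex.exp (Complex.I * Real.pi * x) =
      ⟨Real.cos (Real.pi * x), Real.sin (Real.pi * x)⟩ := fun x => by
    rw [show Complex.I * Real.pi * x = ((Real.pi * x : ℝ) : ℂ) * Complex.I by push_cast; ring]
    exact Complex.ext (Complex.exp_ofReal_mul_I_re _) (Complex.exp_ofReal_mul_I_im _)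
  rw [e, e, planeMap_apply, hM] at h
  simpa [Complex.ext_iff] using h

/-- A diagonal matrix preserves the real axis, so `f 0` is an integer `k`. With `C`, `S` the cosine
and sine of `πφ`, the angle from `(C, S)` to `(|a|C, |b|S)` has tangent `(|b| - |a|)SC / (|a|C² +
|b|S²)`. The first factor is `2 sinh s` in absolute value, and the denominator is at least `2|SC|`
since `|a||b| = 1`. Hence the tangent is at most `sinh s` in absolute value. -/
lemma GLTilde.exists_abs_f_sub_le (g : GLTilde) {a b s : ℝ} (hM : g.M = !![a, 0; 0, b])
    (hab : a * b = 1) (hs : 0 ≤ s) (ha : |a| = Real.exp s ∨ |b| = Real.exp s) :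
    ∃ k : ℤ, ∀ φ, |g.f φ - φ - k| ≤ s := by
  obtain ⟨c₀, hc₀, h1, h2⟩ := g.exists_trig hM 0
  simp only [mul_zero, Real.cos_zero, Real.sin_zero, mul_one] at h1 h2
  obtain ⟨k, hk⟩ := Real.sin_eq_zero_iff.1 ((mul_eq_zero.1 h2.symm).resolve_left hc₀.ne')
  have hk' : g.f 0 = k := by
    rw [mul_comm] at hk
    exact (mul_left_cancel₀ Real.pi_ne_zero hk).symm
  refine ⟨k, fun φ => ?_⟩
  obtain ⟨c, hc, h3, h4⟩ := g.exists_trig hM φ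
  -- `η = (-1)^k` is the common sign of `a` and `b`; multiplying by it replaces them by `|a|` and
  -- `|b|`.
  set η := Real.cos (k * Real.pi) with hη
  have hη2 : η * η = 1 := by
    have := Real.sin_sq_add_cos_sq (k * Real.pi)
    rw [Real.sin_int_mul_pi] at this
    nlinarith
  have haη : a * η = |a| := by
    rw [← hk, ← hη] at h1
    have h5 : 0 < a * η := by rw [h1, mul_assoc, hη2]; linarith
    have h6 : |η| = 1 := by
      rw [← sq_eq_sq₀ (abs_nonneg _) zero_le_one, sq_abs, sq, hη2, one_pow]
    rw [← abs_of_pos h5, abs_mul, h6, mul_one]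
  have hbη : b * η = |b| := by
    have h5 : |a| * (b * η) = 1 := by rw [← haη]; linear_combination hη2 * (a * b) + hab
    have h6 : |a| * |b| = 1 := by rw [← abs_mul, hab, abs_one]
    exact mul_left_cancel₀ (fun h0 => by simp [h0] at h6) (h5.trans h6.symm)
  have hD : Real.pi * (g.f φ - φ - k) = Real.pi * g.f φ - Real.pi * φ - k * Real.pi := by ring
  have hcos : c * Real.cos (Real.pi * (g.f φ - φ - k)) =
      |a| * Real.cos (Real.pi * φ) ^ 2 + |b| * Real.sin (Real.pi * φ) ^ 2 := by
    rw [hD, Real.cos_sub, Real.sin_int_mul_pi, Real.cos_sub, ← haη, ← hbη]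
    linear_combination -(Real.cos (Real.pi * φ) * η) * h3 - (Real.sin (Real.pi * φ) * η) * h4
  have hsin : c * Real.sin (Real.pi * (g.f φ - φ - k)) =
      (|b| - |a|) * (Real.sin (Real.pi * φ) * Real.cos (Real.pi * φ)) := by
    rw [hD, Real.sin_sub, Real.sin_int_mul_pi, Real.sin_sub, ← haη, ← hbη]
    linear_combination (Real.sin (Real.pi * φ) * η) * h3 - (Real.cos (Real.pi * φ) * η) * h4
  have hab' : |a| * |b| = 1 := by rw [← abs_mul, hab, abs_one]
  have ha0 : 0 < |a| := by
    rcases (abs_nonneg a).eq_or_lt with h | h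
    · rw [← h, zero_mul] at hab'; exact absurd hab' zero_ne_one
    · exact h
  have hb0 : 0 < |b| := by
    rcases (abs_nonneg b).eq_or_lt with h | h
    · rw [← h, mul_zero] at hab'; exact absurd hab' zero_ne_one
    · exact h
  have hsinh : |(|b| - |a|)| = 2 * Real.sinh s := by
    rw [Real.sinh_eq, Real.exp_neg]
    have h1s := Real.one_le_exp hs
    have h2s := inv_le_one_of_one_le₀ h1s
    rcases ha with h | h
    · rw [show |b| = (Real.exp s)⁻¹ by rw [← h]; exact eq_inv_of_mul_eq_one_right hab', h,
        abs_of_nonpos (by linarith)]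
      ring
    · rw [show |a| = (Real.exp s)⁻¹ by rw [← h]; exact eq_inv_of_mul_eq_one_left hab', h,
        abs_of_nonneg (by linarith)]
      ring
  have hamgm : 2 * |Real.sin (Real.pi * φ) * Real.cos (Real.pi * φ)| ≤
      |a| * Real.cos (Real.pi * φ) ^ 2 + |b| * Real.sin (Real.pi * φ) ^ 2 := by
    set S := Real.sin (Real.pi * φ)
    set C := Real.cos (Real.pi * φ)
    have h5 : 0 ≤ (|a| * |C| - |S|) ^ 2 := sq_nonneg _
    -- Expanded with `|a||b| = 1`, this square is exactly `|a|C² - 2|C||S| + |b|S²`.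
    have h6 : 0 ≤ |b| * (|a| * |C| - |S|) ^ 2 := mul_nonneg hb0.le h5
    rw [abs_mul, ← sq_abs C, ← sq_abs S]
    linear_combination h6 + hab' * (|a| * |C| ^ 2 - 2 * |C| * |S|)
  have hpos : 0 < |a| * Real.cos (Real.pi * φ) ^ 2 + |b| * Real.sin (Real.pi * φ) ^ 2 := by
    have h5 := Real.sin_sq_add_cos_sq (Real.pi * φ)
    rcases (sq_nonneg (Real.sin (Real.pi * φ))).eq_or_lt with h6 | h6
    · rw [← h6] at h5 ⊢
      rw [zero_add] at h5
      rw [h5]; linarith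
    · have := mul_pos hb0 h6
      have := mul_nonneg ha0.le (sq_nonneg (Real.cos (Real.pi * φ)))
      linarith
  refine abs_le_of_abs_sin_le ?_ hs ?_ ?_
  -- Since `f n = n + k` at integers `n`, both `φ` and `f φ - k` lie in `[⌊φ⌋, ⌊φ⌋ + 1)`.
  · have hfl := g.f_add_int 0 ⌊φ⌋
    have hfl' := g.f_add_int 0 (⌊φ⌋ + 1)
    rw [zero_add, hk'] at hfl hfl'
    have h5 := g.f.monotone (Int.floor_le φ)
    have h6 := g.f.strictMono (Int.lt_floor_add_one φ)
    have h7 := Int.floor_le φ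
    have h8 := Int.lt_floor_add_one φ
    push_cast at hfl'
    rw [hfl] at h5
    rw [hfl'] at h6
    rw [abs_lt]
    constructor <;> linarith
  · rw [← hcos] at hpos
    exact pos_of_mul_pos_right hpos hc.le
  · rw [← mul_le_mul_iff_right₀ hc, ← abs_of_pos hc, ← abs_mul, abs_of_pos hc, hsin, abs_mul, hsinh]
    rw [mul_left_comm, hcos]
    have := mul_le_mul_of_nonneg_left hamgm (Real.sinh_nonneg_iff.2 hs)
    linarith

end Phase

/-! ### Upper and lower bounds for the quotient metric; growth of masses. -/

section Metric

/-- On a finite-dimensional space, linear functionals are bounded with respect to any norm. -/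
lemma exists_abs_le_mul_seminorm {V : Type*} [AddCommGroup V] [Module ℝ V]
    [FiniteDimensional ℝ V] (N : Seminorm ℝ V) (hN : ∀ x, N x = 0 → x = 0) (g : V →ₗ[ℝ] ℝ) :
    ∃ c : ℝ, 0 ≤ c ∧ ∀ x, |g x| ≤ c * N x := by
  let _ : Norm V := ⟨N⟩
  have core : NormedSpace.Core ℝ V :=
    { norm_nonneg := fun x => apply_nonneg N x
      norm_smul := fun c x => map_smul_eq_mul N c x
      norm_triangle := fun x y => map_add_le_add N x y
      norm_eq_zero_iff := fun x => ⟨hN x, fun h => by rw [h]; exact map_zero N⟩ }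
  let _ : NormedAddCommGroup V := NormedAddCommGroup.ofCore core
  let _ : NormedSpace ℝ V := NormedSpace.ofCore core
  exact ⟨‖LinearMap.toContinuousLinearMap g‖, norm_nonneg _,
    fun x => (LinearMap.toContinuousLinearMap g).le_opNorm x⟩


/-- The points at finite distance from `x` form a clopen set: points at distance less than one are
either both in it or both outside. -/
lemma connectedComponent_subset_edist_lt_top {X : Type*} [PseudoEMetricSpace X] (x : X) :
    ∀ y ∈ connectedComponent x, edist y x < ⊤ := by
  have h : IsClopen {y : X | edist y x < ⊤} := by
    constructor
    · rw [← isOpen_compl_iff, EMetric.isOpen_iff]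
      intro y hy
      refine ⟨1, one_pos, fun z hz hz' => hy ?_⟩
      exact (edist_triangle_left y x z).trans_lt (ENNReal.add_lt_top.2 ⟨hz.trans_le le_top, hz'⟩)
    · rw [EMetric.isOpen_iff]
      intro y hy
      refine ⟨1, one_pos, fun z hz => ?_⟩
      exact (edist_triangle z y x).trans_lt (ENNReal.add_lt_top.2 ⟨hz.trans_le le_top, hy⟩)
  exact h.connectedComponent_subset (by simp)

section Iterates

variable {C : Type u} [Category.{v} C] [HasZeroMorphisms C] (F : C ≌ C)

lemma not_isZero_functor_iterate {E : C} (h : ¬ IsZero E) (n : ℕ) :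
    ¬ IsZero (F.functor.obj^[n] E) := by
  induction n with
  | zero => exact h
  | succ n ih => rw [Function.iterate_succ_apply']; exact not_isZero_functor_obj F ih

lemma not_isZero_inverse_iterate {E : C} (h : ¬ IsZero E) (n : ℕ) :
    ¬ IsZero (F.inverse.obj^[n] E) := by
  induction n with
  | zero => exact h
  | succ n ih => rw [Function.iterate_succ_apply']; exact not_isZero_inverse_obj F ih

end Iterates

variable {T : Type u} [Category.{v} T] [HasZeroObject T] [HasShift T ℤ] [Preadditive T]
  [∀ n : ℤ, (shiftFunctor T n).Additive] [Pretriangulated T]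

namespace StabilityCondition

lemma abs_log_mass_le_dB (σ τ : StabilityCondition T) (h : dB σ τ ≠ ⊤)
    (E : {E : T // ¬ IsZero E}) :
    |Real.log (σ.mass E) - Real.log (τ.mass E)| ≤ (dB σ τ).toReal := by
  rw [← Real.log_div (σ.mass_pos E).ne' (τ.mass_pos E).ne']
  refine (ENNReal.ofReal_le_iff_le_toReal h).1 ?_
  exact (le_max_right _ _).trans (le_iSup (fun E : {E : T // ¬ IsZero E} =>
    max (max (ENNReal.ofReal |σ.phiPlus E - τ.phiPlus E|)
      (ENNReal.ofReal |σ.phiMinus E - τ.phiMinus E|))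
      (ENNReal.ofReal |Real.log (σ.mass E / τ.mass E)|)) E)

/-- The masses for `σ` are bounded by a multiple of the masses for `τ`. -/
lemma exists_mass_le_of_dB_lt_top {σ τ : StabilityCondition T} (h : dB σ τ < ⊤) :
    ∃ C : ℝ, 0 < C ∧ ∀ E, σ.mass E ≤ C * τ.mass E := by
  refine ⟨Real.exp (dB σ τ).toReal, Real.exp_pos _, fun E => ?_⟩
  have h1 := (abs_le.1 (σ.abs_log_mass_le_dB τ h.ne E)).2
  rw [← Real.exp_log (σ.mass_pos E), ← Real.exp_log (τ.mass_pos E), ← Real.exp_add]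
  exact Real.exp_le_exp.2 (by linarith)

lemma dB_comm (σ τ : StabilityCondition T) : dB σ τ = dB τ σ := edist_comm σ τ

/-- Phases are controlled by `exists_abs_f_sub_le`; masses, because the matrix and its inverse both
have operator norm at most `exp s`. -/
lemma dBbar_actGL_le (σ : StabilityCondition T) (g : GLTilde) {a b s : ℝ}
    (hM : g.M = !![a, 0; 0, b]) (hab : a * b = 1) (hs : 0 ≤ s)
    (ha : |a| = Real.exp s ∨ |b| = Real.exp s) :
    dBbar σ (σ.actGL g) ≤ ENNReal.ofReal s := by
  obtain ⟨k, hk⟩ := g.exists_abs_f_sub_le hM hab hs ha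
  -- The translation by `-k` undoes the integer rotation contained in `f`; being real, it leaves
  -- masses unchanged.
  refine (iInf_le _ (-(k : ℂ))).trans (iSup_le fun E => ?_)
  have hphase : ∀ ψ : ℝ, |ψ - (g.f.symm ψ + k)| ≤ s := fun ψ => by
    have := hk (g.f.symm ψ)
    rwa [OrderIso.apply_symm_apply, sub_sub] at this
  refine max_le (max_le (ENNReal.ofReal_le_ofReal ?_) (ENNReal.ofReal_le_ofReal ?_))
    (ENNReal.ofReal_le_ofReal ?_)
  · rw [phiPlus_actC, phiPlus_actGL]
    simpa using hphase (σ.phiPlus E)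
  · rw [phiMinus_actC, phiMinus_actGL]
    simpa using hphase (σ.phiMinus E)
  · have hbound : |a| ≤ Real.exp s ∧ |b| ≤ Real.exp s := by
      have h1 : |a| * |b| = 1 := by rw [← abs_mul, hab, abs_one]
      have h2 := Real.one_le_exp hs
      rcases ha with h | h
      · refine ⟨h.le, ?_⟩
        rw [h] at h1
        nlinarith [abs_nonneg b]
      · refine ⟨?_, h.le⟩
        rw [h] at h1
        nlinarith [abs_nonneg a]
    have hinv : g.M⁻¹ = !![b, 0; 0, a] := by
      rw [hM]
      refine Matrix.inv_eq_left_inv ?_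
      ext i j
      fin_cases i <;> fin_cases j <;> simp [Matrix.mul_apply, Fin.sum_univ_two, hab, mul_comm b a]
    have h1 : ∀ z, ‖planeMap g.M⁻¹ z‖ ≤ Real.exp s * ‖z‖ := fun z => by
      have := norm_diagonal_le hbound.2 hbound.1 z
      rw [planeMap_apply, hinv]
      simpa using this
    have h2 : ∀ z, ‖z‖ ≤ Real.exp s * ‖planeMap g.M⁻¹ z‖ := fun z => by
      have := norm_diagonal_le hbound.1 hbound.2 (planeMap g.M⁻¹ z)
      rw [show (⟨a * (planeMap g.M⁻¹ z).re, b * (planeMap g.M⁻¹ z).im⟩ : ℂ) =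
        planeMap g.M (planeMap g.M⁻¹ z) by rw [planeMap_apply g.M, hM]; simp, ← planeMap_mul,
        g.mul_inv, planeMap_one] at this
      exact this
    have hm1 : (σ.actGL g).mass E ≤ Real.exp s * σ.mass E := by
      rw [mass_actGL, mass, Finset.mul_sum]
      exact Finset.sum_le_sum fun i _ => h1 _
    have hm2 : σ.mass E ≤ Real.exp s * (σ.actGL g).mass E := by
      rw [mass_actGL, mass, Finset.mul_sum]
      exact Finset.sum_le_sum fun i _ => h2 _
    have hc : ((σ.actGL g).actC (-(k : ℂ))).mass E = (σ.actGL g).mass E := by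
      rw [mass_actC]; simp
    have hp1 := σ.mass_pos E
    have hp2 := (σ.actGL g).mass_pos E
    rw [hc, Real.log_div hp1.ne' hp2.ne', abs_le]
    have hl1 := Real.log_le_log hp2 hm1
    have hl2 := Real.log_le_log hp1 hm2
    rw [Real.log_mul (Real.exp_ne_zero s) hp1.ne', Real.log_exp] at hl1
    rw [Real.log_mul (Real.exp_ne_zero s) hp2.ne', Real.log_exp] at hl2
    constructor <;> linarith

lemma le_of_forall_nat_mul_le {x d c : ℝ} (h : ∀ n : ℕ, n * x ≤ n * d + c) : x ≤ d := by
  by_contra! hlt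
  obtain ⟨n, hn⟩ := exists_nat_gt (c / (x - d))
  rw [div_lt_iff₀ (by linarith)] at hn
  linarith [h n]

/-- A lower bound for the distance of `σ` and `F.σ` modulo `ℂ` in terms of the exponential growth
of masses under both `F` and its inverse. -/
lemma le_dBbar_actAut (σ : StabilityCondition T) (F : T ≌ T) [F.functor.CommShift ℤ]
    [F.functor.IsTriangulated] (E : {E : T // ¬ IsZero E}) {ρ c c' : ℝ} (hρ : 0 < ρ) (hc : 0 < c)
    (hc' : 0 < c')
    (h : ∀ n, c * ρ ^ n ≤ σ.mass ⟨F.functor.obj^[n] E.1, not_isZero_functor_iterate F E.2 n⟩)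
    (h' : ∀ n, c' * ρ ^ n ≤ σ.mass ⟨F.inverse.obj^[n] E.1, not_isZero_inverse_iterate F E.2 n⟩) :
    ENNReal.ofReal (Real.log ρ) ≤ dBbar σ (σ.actAut F) := by
  refine le_iInf fun z => ?_
  by_cases htop : dB σ ((σ.actAut F).actC z) = ⊤
  · rw [htop]; exact le_top
  rw [ENNReal.ofReal_le_iff_le_toReal htop]
  set d := (dB σ ((σ.actAut F).actC z)).toReal with hd
  have key : ∀ A : {E : T // ¬ IsZero E}, |Real.log (σ.mass A) - Real.pi * z.im -
      Real.log (σ.mass ⟨F.inverse.obj A.1, not_isZero_inverse_obj F A.2⟩)| ≤ d := fun A => by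
    have := σ.abs_log_mass_le_dB _ htop A
    rwa [mass_actC, Real.log_mul (Real.exp_ne_zero _) (mass_pos _ _).ne', Real.log_exp,
      mass_actAut, ← sub_sub] at this
  -- Each application of `F` raises the log mass by at most `d + π Im z`; each application of the
  -- inverse, in `h2`, by at most `d - π Im z`.
  have h1 : ∀ n : ℕ, Real.log (σ.mass ⟨F.functor.obj^[n] E.1, not_isZero_functor_iterate F E.2 n⟩) ≤
      n * (d + Real.pi * z.im) + Real.log (σ.mass E) := by
    intro n
    induction n with
    | zero => simp
    | succ n ih =>
      have hk := (abs_le.1 (key ⟨F.functor.obj^[n + 1] E.1,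
        not_isZero_functor_iterate F E.2 (n + 1)⟩)).2
      rw [σ.mass_iso (E := ⟨F.inverse.obj (F.functor.obj^[n + 1] E.1), _⟩)
        (E' := ⟨F.functor.obj^[n] E.1, not_isZero_functor_iterate F E.2 n⟩)
        (eqToIso (congrArg F.inverse.obj (Function.iterate_succ_apply' _ _ _)) ≪≫ (F.unitIso.app _).symm)] at hk
      push_cast
      linarith
  have h2 : ∀ n : ℕ, Real.log (σ.mass ⟨F.inverse.obj^[n] E.1, not_isZero_inverse_iterate F E.2 n⟩) ≤
      n * (d - Real.pi * z.im) + Real.log (σ.mass E) := by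
    intro n
    induction n with
    | zero => simp
    | succ n ih =>
      have hk := (abs_le.1 (key ⟨F.inverse.obj^[n] E.1, not_isZero_inverse_iterate F E.2 n⟩)).1
      rw [σ.mass_iso (E := ⟨F.inverse.obj (F.inverse.obj^[n] E.1), _⟩)
        (E' := ⟨F.inverse.obj^[n + 1] E.1, not_isZero_inverse_iterate F E.2 (n + 1)⟩)
        (eqToIso (Function.iterate_succ_apply' _ _ _).symm)] at hk
      push_cast
      linarith
  -- The constant comes from averaging the bounds for `F` and its inverse, in which the terms in `Im
  -- z` cancel.
  refine le_of_forall_nat_mul_le (c := Real.log (σ.mass E) - (Real.log c + Real.log c') / 2)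
    fun n => ?_
  have h3 := Real.log_le_log (by positivity) (h n)
  have h4 := Real.log_le_log (by positivity) (h' n)
  rw [Real.log_mul hc.ne' (by positivity), Real.log_pow] at h3
  rw [Real.log_mul hc'.ne' (by positivity), Real.log_pow] at h4
  linarith [h1 n, h2 n]

/-- If the central charges of semistable objects are bounded away from zero, then masses grow
exponentially under a functor which acts on central charges by a hyperbolic map. -/
lemma Equivariant.exists_mass_bounds {σ : StabilityCondition T} {Φ : T ⥤ T} {κ : ℝ → ℝ}
    {B : ℂ → ℂ} (h : σ.Equivariant Φ κ B) {ρ ε : ℝ} (hB : IsHyperbolic B ρ) (hρ : 1 < ρ)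
    (hε : 0 < ε) (hdisc : ∀ φ A, σ.P φ A → ¬ IsZero A → ε ≤ ‖σ.Z (K0.cls A)‖)
    (E : {E : T // ¬ IsZero E}) : ∃ c : ℝ, 0 < c ∧ ∀ n : ℕ,
      c * ρ ^ n ≤ σ.mass ⟨Φ.obj^[n] E.1, h.not_isZero_iterate n E.2⟩ ∧
      σ.mass ⟨Φ.obj^[n] E.1, h.not_isZero_iterate n E.2⟩ ≤ ρ ^ n * σ.mass E := by
  -- One factor suffices for the lower bound: its iterates remain semistable, so their central
  -- charges never enter the `ε`-disc.
  obtain ⟨c, hc, hcn⟩ := hB.exists_bounds hρ hε (z := σ.Z (K0.cls ((σ.hn E).factor 0)))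
    fun n => by
      rw [← h.Z_iterate]
      exact hdisc _ _ (h.mem_iterate n ((σ.hn E).factor_mem 0))
        (h.not_isZero_iterate n ((σ.hn E).factor_ne_zero 0))
  refine ⟨c, hc, fun n => ⟨?_, ?_⟩⟩
  · rw [h.mass_iterate]
    exact (hcn n).trans (Finset.single_le_sum
      (f := fun i => ‖B^[n] (σ.Z (K0.cls ((σ.hn E).factor i)))‖)
      (fun i _ => norm_nonneg _) (Finset.mem_univ 0))
  · rw [h.mass_iterate, mass, Finset.mul_sum]
    obtain ⟨x, y, hxy⟩ := hB
    exact Finset.sum_le_sum fun i _ => (hxy n _).2.1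

/-- The support property bounds the central charges of semistable objects away from zero. -/
lemma exists_le_norm_Z (σ : StabilityCondition T) [Module.Finite ℤ (K0 T)] :
    ∃ ε : ℝ, 0 < ε ∧ ∀ φ A, σ.P φ A → ¬ IsZero A → ε ≤ ‖σ.Z (K0.cls A)‖ := by
  obtain ⟨N, hN, C, hC, hsupp⟩ := σ.support
  -- Coordinates on `K₀` modulo torsion are integers, so a nonzero one has absolute value at least
  -- `1`; the seminorm dominates them, and the support property bounds the seminorm by `‖Z‖`.
  let b := Module.Free.chooseBasis ℤ (K0 T ⧸ Submodule.torsion ℤ (K0 T))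
  let f := fun i => (b.coord i).comp (Submodule.torsion ℤ (K0 T)).mkQ
  let g := fun i => (Algebra.linearMap ℤ ℝ).comp (f i)
  have hg : ∀ i, ∃ c : ℝ, 0 ≤ c ∧ ∀ x : K0 T, |(f i x : ℝ)| ≤ c * N ((1 : ℝ) ⊗ₜ[ℤ] x) := by
    intro i
    obtain ⟨c, hc, h⟩ := exists_abs_le_mul_seminorm N hN ((g i).liftBaseChange ℝ)
    refine ⟨c, hc, fun x => ?_⟩
    simpa [g] using h ((1 : ℝ) ⊗ₜ[ℤ] x)
  choose c hc hcf using hg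
  refine ⟨1 / ((∑ i, c i + 1) * C), ?_, fun φ A hA h0 => ?_⟩
  · have := Finset.sum_nonneg fun i (_ : i ∈ Finset.univ) => hc i
    positivity
  have hsum := Finset.sum_nonneg fun i (_ : i ∈ Finset.univ) => hc i
  have hZ : σ.Z (K0.cls A) ≠ 0 := by
    obtain ⟨m, hm, h⟩ := σ.phase_eq _ _ hA h0
    rw [h]
    exact mul_ne_zero (by exact_mod_cast hm.ne') (Complex.exp_ne_zero _)
  have hf : ∃ i, f i (K0.cls A) ≠ 0 := by
    -- A class with all coordinates zero is torsion, hence killed by `Z`, which is impossible for a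
    -- semistable object.
    by_contra! hall
    have h1 : (Submodule.torsion ℤ (K0 T)).mkQ (K0.cls A) = 0 :=
      b.ext_elem fun i => by simpa [f] using hall i
    rw [Submodule.mkQ_apply, Submodule.Quotient.mk_eq_zero, Submodule.mem_torsion_iff] at h1
    obtain ⟨a, ha⟩ := h1
    have h2 : (a : ℤ) • σ.Z (K0.cls A) = 0 := by
      rw [← map_zsmul]
      exact (congrArg σ.Z ha).trans (map_zero _)
    exact hZ ((smul_eq_zero.1 h2).resolve_left (nonZeroDivisors.coe_ne_zero a))
  obtain ⟨i, hi⟩ := hf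
  have h1 : (1 : ℝ) ≤ |(f i (K0.cls A) : ℝ)| := by exact_mod_cast Int.one_le_abs hi
  have h2 : c i ≤ ∑ i, c i + 1 :=
    (Finset.single_le_sum (fun i _ => hc i) (Finset.mem_univ i)).trans (by linarith)
  rw [div_le_iff₀ (by positivity)]
  calc (1 : ℝ) ≤ c i * N ((1 : ℝ) ⊗ₜ[ℤ] K0.cls A) := h1.trans (hcf i _)
    _ ≤ (∑ i, c i + 1) * (C * ‖σ.Z (K0.cls A)‖) :=
        mul_le_mul h2 (hsupp φ A hA h0).le (apply_nonneg N _) (by positivity)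
    _ = _ := by ring

end StabilityCondition

end Metric

/-! ### Building objects from shifts of a generator; complexity. -/

section Cost

variable {T : Type u} [Category.{v} T] [HasZeroObject T] [HasShift T ℤ] [Preadditive T]
  [∀ n : ℤ, (shiftFunctor T n).Additive] [Pretriangulated T]

/-- Objects which are the end of a tower of `p` triangles whose cones are shifts of `G`. -/
def shiftTower (G : T) (p : ℕ) : ObjectProperty T :=
  fun E => ∃ n : Fin p → ℤ, IsTower (fun i => G⟦n i⟧) E

/-- Direct summands of objects which are the end of a tower of `p` triangles whose cones are shifts
of `G`. -/
def HasCost (G : T) (p : ℕ) : ObjectProperty T := (shiftTower G p).retractClosure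

instance (G : T) (p : ℕ) : (shiftTower G p).IsClosedUnderIsomorphisms where
  of_iso e := fun ⟨n, h⟩ => ⟨n, h.of_iso e⟩

instance (G : T) (p : ℕ) : (HasCost G p).IsStableUnderRetracts :=
  inferInstanceAs (shiftTower G p).retractClosure.IsStableUnderRetracts

/-- Puts towers in the language of extension products, whose associativity encodes the octahedral
axiom. -/
lemma shiftTower_succ (G : T) (p : ℕ) : shiftTower G (p + 1) =
    ObjectProperty.extensionProduct (shiftTower G p) (fun E => ∃ n : ℤ, E = G⟦n⟧) := by
  ext E
  constructor
  · rintro ⟨n, h⟩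
    obtain ⟨X, f, g, k, hX, hd⟩ := (isTower_succ_iff _ _).1 h
    exact ⟨X, _, f, g, k, hd, ⟨_, hX⟩, ⟨_, rfl⟩⟩
  · rintro ⟨X, _, f, g, k, hd, ⟨n, hX⟩, ⟨m, rfl⟩⟩
    refine ⟨Fin.snoc n m, (isTower_succ_iff _ _).2 ?_⟩
    simp only [Fin.snoc_castSucc]
    rw [show (Fin.snoc n m : Fin (p + 1) → ℤ) (Fin.last p) = m from Fin.snoc_last _ _]
    exact ⟨X, f, g, k, hX, hd⟩

lemma shiftTower_zero_iff (G E : T) : shiftTower G 0 E ↔ IsZero E :=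
  ⟨fun ⟨_, h⟩ => (isTower_zero_iff _ _).1 h,
    fun h => ⟨fun i => i.elim0, (isTower_zero_iff _ _).2 h⟩⟩

/-- Towers are concatenated by moving the cones of `Z` onto `X` one at a time, by associativity of
extension products. -/
lemma shiftTower_add [IsTriangulated T] (G : T) (p q : ℕ) {X Y Z : T} {f : X ⟶ Y} {g : Y ⟶ Z}
    {h : Z ⟶ X⟦(1 : ℤ)⟧} (hd : Triangle.mk f g h ∈ (distTriang T)) (hX : shiftTower G p X)
    (hZ : shiftTower G q Z) : shiftTower G (p + q) Y := by
  induction q generalizing X Y Z with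
  | zero =>
    have := (Triangle.isZero₃_iff_isIso₁ _ hd).1 ((shiftTower_zero_iff G Z).1 hZ)
    exact (shiftTower G p).prop_of_iso (@asIso _ _ X Y f this) hX
  | succ q ih =>
    have h1 : ObjectProperty.extensionProduct (shiftTower G p)
        (ObjectProperty.extensionProduct (shiftTower G q) (fun E => ∃ n : ℤ, E = G⟦n⟧)) Y :=
      ⟨X, Z, f, g, h, hd, hX, by rwa [← shiftTower_succ]⟩
    rw [← ObjectProperty.extensionProduct_assoc] at h1
    obtain ⟨Y', B, a, b, c, hd', ⟨X', Z', a', b', c', hd'', hX', hZ'⟩, hB⟩ := h1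
    rw [← add_assoc, shiftTower_succ]
    exact ⟨Y', B, a, b, c, hd', ih hd'' hX' hZ', hB⟩

lemma HasCost.add [IsTriangulated T] {G : T} {p q : ℕ} {X Y Z : T} {f : X ⟶ Y} {g : Y ⟶ Z}
    {h : Z ⟶ X⟦(1 : ℤ)⟧} (hd : Triangle.mk f g h ∈ (distTriang T)) (hX : HasCost G p X)
    (hZ : HasCost G q Z) : HasCost G (p + q) Y := by
  -- An extension of retracts is a retract of an extension.
  have h1 := ObjectProperty.extensionProduct_retractClosure_retractClosure_le
    (shiftTower G p) (shiftTower G q) Y ⟨X, Z, f, g, h, hd, hX, hZ⟩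
  refine ObjectProperty.monotone_retractClosure ?_ _ h1
  rintro W ⟨X, Z, f, g, h, hd, hX, hZ⟩
  exact shiftTower_add G p q hd hX hZ

lemma hasCost_zero (G : T) {E : T} (hE : IsZero E) : HasCost G 0 E :=
  ObjectProperty.le_retractClosure _ _ ((shiftTower_zero_iff G E).2 hE)

lemma hasCost_self (G : T) : HasCost G 1 G :=
  ObjectProperty.le_retractClosure _ _
    ⟨fun _ => 0, isTower_one ((shiftFunctorZero T ℤ).app G)⟩

lemma HasCost.shift {G : T} {p : ℕ} {E : T} (h : HasCost G p E) (m : ℤ) :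
    HasCost G p (E⟦m⟧) := by
  obtain ⟨Y, ⟨n, hY⟩, ⟨r⟩⟩ := h
  exact ⟨Y⟦m⟧, ⟨fun i => n i + m,
    (hY.shift m).of_factor_iso fun i => ((shiftFunctorAdd T (n i) m).app G).symm⟩,
    ⟨r.map (shiftFunctor T m)⟩⟩

lemma HasCost.of_iso {G : T} {p : ℕ} {E E' : T} (h : HasCost G p E) (e : E ≅ E') :
    HasCost G p E' :=
  (HasCost G p).prop_of_retract (Retract.ofIso e.symm) h

/-- Padding: one more copy of `G` is added as a direct summand. -/
lemma HasCost.mono {G : T} {p q : ℕ} {E : T} (h : HasCost G p E) (hpq : p ≤ q) :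
    HasCost G q E := by
  induction q, hpq using Nat.le_induction with
  | base => exact h
  | succ q _ ih =>
    obtain ⟨Y, ⟨n, hY⟩, ⟨r⟩⟩ := ih
    refine ⟨Y ⊞ G⟦(0 : ℤ)⟧, ⟨Fin.snoc n 0, (isTower_succ_iff _ _).2 ?_⟩,
      ⟨r.trans ⟨biprod.inl, biprod.fst, biprod.inl_fst⟩⟩⟩
    simp only [Fin.snoc_castSucc]
    rw [show (Fin.snoc n 0 : Fin (q + 1) → ℤ) (Fin.last q) = 0 from Fin.snoc_last _ _]
    exact ⟨Y, _, _, _, hY, binaryBiproductTriangle_distinguished Y (G⟦(0 : ℤ)⟧)⟩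

lemma IsTower.hasCost [IsTriangulated T] {G : T} {p : ℕ} {A : Fin p → T} {E : T}
    (h : IsTower A E) {c : Fin p → ℕ} (hc : ∀ i, HasCost G (c i) (A i)) :
    HasCost G (∑ i, c i) E := by
  induction p generalizing E with
  | zero => simpa using hasCost_zero G ((isTower_zero_iff _ _).1 h)
  | succ p ih =>
    obtain ⟨X, f, g, k, hX, hd⟩ := (isTower_succ_iff _ _).1 h
    rw [Fin.sum_univ_castSucc]
    exact HasCost.add hd (ih hX fun i => hc _) (hc _)

/-- The objects which can be built from `G`. -/
def finiteCost (G : T) : ObjectProperty T := fun E => ∃ p, HasCost G p E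

instance (G : T) : (finiteCost G).IsStableUnderRetracts where
  of_retract r := fun ⟨p, h⟩ => ⟨p, ObjectProperty.prop_of_retract _ r h⟩

instance [IsTriangulated T] (G : T) : (finiteCost G).IsTriangulated where
  exists_zero := by
    obtain ⟨Z, hZ⟩ := HasZeroObject.zero (C := T)
    exact ⟨Z, hZ, 0, hasCost_zero G hZ⟩
  isStableUnderShiftBy n := ⟨fun E ⟨p, h⟩ => ⟨p, h.shift n⟩⟩
  toIsTriangulatedClosed₂ := .mk' fun t ht ⟨p, h⟩ ⟨q, h'⟩ => ⟨p + q, HasCost.add ht h h'⟩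

/-- The objects of finite cost form a triangulated subcategory closed under retracts and containing
`G`. -/
lemma IsSplitGenerator.exists_hasCost [IsTriangulated T] {G : T} (hG : IsSplitGenerator G) (E : T) :
    ∃ p, HasCost G p E := by
  have h : (ObjectProperty.singleton G).triangEnvelope ≤ finiteCost G := by
    rw [ObjectProperty.triangEnvelope_le_iff]
    rintro _ ⟨⟩
    exact ⟨1, hasCost_self G⟩
  refine h E ?_
  rw [IsSplitGenerator, ObjectProperty.isClassicalTriangulatedGenerator_iff] at hG
  rw [hG]
  trivial

/-- A split monomorphism in a triangulated category has a complement, namely its cone. This matches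
retracts with the `E ⊞ M` in `complexity`. -/
lemma hasCost_iff (G : T) (p : ℕ) (E : T) : HasCost G p E ↔
    ∃ (M : T) (n : Fin p → ℤ), IsTower (fun i => G⟦n i⟧) (E ⊞ M) := by
  constructor
  · rintro ⟨Y, ⟨n, hY⟩, ⟨r⟩⟩
    obtain ⟨M, g, h, hd⟩ := distinguished_cocone_triangle r.i
    have : Mono r.i := mono_of_mono_fac r.retract
    obtain ⟨e, -⟩ := exists_iso_binaryBiproduct_of_distTriang _ hd
      (Triangle.mor₃_eq_zero_of_mono₁ _ hd this)
    exact ⟨M, n, hY.of_iso e⟩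
  · rintro ⟨M, n, h⟩
    exact ⟨E ⊞ M, ⟨n, h⟩, ⟨⟨biprod.inl, biprod.fst, biprod.inl_fst⟩⟩⟩

lemma complexity_le {G : T} {p : ℕ} {E : T} (hp : 0 < p) (h : HasCost G p E) :
    complexity G E ≤ p :=
  Nat.sInf_le ⟨hp, (hasCost_iff _ _ _).1 h⟩

/-- Since `sInf ∅ = 0`, a witness is needed for the infimum to be attained; it is positive because
only zero objects have cost `0`. -/
lemma hasCost_complexity {G : T} {p : ℕ} {E : T} (hE : ¬ IsZero E) (h : HasCost G p E) :
    0 < complexity G E ∧ HasCost G (complexity G E) E := by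
  have hp : 0 < p := by
    rw [Nat.pos_iff_ne_zero]
    rintro rfl
    obtain ⟨Y, hY, ⟨r⟩⟩ := h
    refine hE ((IsZero.iff_id_eq_zero _).2 ?_)
    rw [← r.retract, ((shiftTower_zero_iff G Y).1 hY).eq_of_src r.r 0, comp_zero]
  obtain ⟨h1, h2⟩ := Nat.sInf_mem (s := {p : ℕ | 0 < p ∧ ∃ (M : T) (n : Fin p → ℤ),
    IsTower (fun i => G⟦n i⟧) (E ⊞ M)}) ⟨p, hp, (hasCost_iff _ _ _).1 h⟩
  exact ⟨h1, (hasCost_iff _ _ _).2 h2⟩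

end Cost

/-! ### Dimensions of representations and the simple ones at the vertices. -/

section Representations

open Module

lemma finrank_le_of_exact {S : ShortComplex (ModuleCat.{0} ℂ)} (hS : S.Exact)
    [Module.Finite ℂ S.X₁] [Module.Finite ℂ S.X₂] [Module.Finite ℂ S.X₃] :
    finrank ℂ S.X₂ ≤ finrank ℂ S.X₁ + finrank ℂ S.X₃ := by
  have h1 := S.g.hom.finrank_range_add_finrank_ker
  rw [← hS.moduleCat_range_eq_ker] at h1
  have h2 := S.f.hom.finrank_range_le
  have h3 := Submodule.finrank_le (LinearMap.range S.g.hom)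
  omega

lemma finrank_eq_of_shortExact {S : ShortComplex (ModuleCat.{0} ℂ)} (hS : S.ShortExact)
    [Module.Finite ℂ S.X₁] [Module.Finite ℂ S.X₂] [Module.Finite ℂ S.X₃] :
    finrank ℂ S.X₂ = finrank ℂ S.X₁ + finrank ℂ S.X₃ := by
  have h1 := S.g.hom.finrank_range_add_finrank_ker
  rw [← hS.exact.moduleCat_range_eq_ker, LinearMap.finrank_range_of_inj
    ((ModuleCat.mono_iff_injective _).1 hS.mono_f), LinearMap.range_eq_top.2
    ((ModuleCat.epi_iff_surjective _).1 hS.epi_g), finrank_top] at h1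
  omega

variable {Q : Type u} [Quiver.{v} Q]

variable (Q) in
/-- The vector space of a representation at a vertex. -/
def atVertex (a : Paths Q) : RepFD Q ⥤ ModuleCat.{0} ℂ :=
  (evaluation (Paths Q) (FGModuleCat.{0} ℂ)).obj a ⋙ forget₂ (FGModuleCat.{0} ℂ) (ModuleCat.{0} ℂ)

instance (a : Paths Q) : PreservesFiniteLimits (atVertex Q a) :=
  comp_preservesFiniteLimits _ _

instance (a : Paths Q) : PreservesFiniteColimits (atVertex Q a) :=
  comp_preservesFiniteColimits _ _

instance (a : Paths Q) : (atVertex Q a).Additive :=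
  inferInstanceAs (_ ⋙ _ : RepFD Q ⥤ ModuleCat.{0} ℂ).Additive

instance (a : Paths Q) (M : RepFD Q) : Module.Finite ℂ ((atVertex Q a).obj M) :=
  inferInstanceAs (Module.Finite ℂ (M.obj a))

variable (Q) in
/-- The simple representation at a vertex. -/
def simpleRep (a : Paths Q) : RepFD Q :=
  Paths.lift { obj := fun b => FGModuleCat.of ℂ (PLift (b = a) → ℂ), map := fun _ => 0 }

lemma simpleRep_map_toPath (a : Paths Q) {b c : Q} (f : b ⟶ c) :
    (simpleRep Q a).map f.toPath = 0 :=
  Paths.lift_toPath _ f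

/-- The component at `b` of the morphism to the simple representation at `a` given by a linear
functional. -/
def toSimpleApp {M : RepFD Q} {a : Paths Q} (ξ : M.obj a →ₗ[ℂ] ℂ) (b : Paths Q) :
    M.obj b →ₗ[ℂ] (PLift (b = a) → ℂ) :=
  LinearMap.pi fun h => h.down ▸ ξ

lemma toSimpleApp_self {M : RepFD Q} {a : Paths Q} (ξ : M.obj a →ₗ[ℂ] ℂ) (x : M.obj a)
    (h : PLift (a = a)) : toSimpleApp ξ a x h = ξ x := rfl

/-- Naturality along an arrow `b ⟶ c`: the target is zero unless `c = a`, and in that case `M`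
vanishes at `b`. Arrows act by zero on the simple representation, so both sides of the square
vanish. -/
lemma comp_toSimpleApp_eq_zero {M : RepFD Q} {a : Paths Q} (ξ : M.obj a →ₗ[ℂ] ℂ)
    (h : ∀ (b : Paths Q) (_ : Quiver.Hom (V := Q) b a), Subsingleton (M.obj b))
    {b c : Paths Q} (f : Quiver.Hom (V := Q) b c) (g : M.obj b ⟶ M.obj c) :
    g ≫ FGModuleCat.ofHom (toSimpleApp ξ c) = 0 := by
  ext x ⟨rfl⟩
  have := h b f
  have hx : x = 0 := Subsingleton.elim (α := M.obj b) _ _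
  rw [hx, map_zero, map_zero]

/-- The morphism to the simple representation at `a` given by a linear functional. -/
def toSimple {M : RepFD Q} {a : Paths Q} (ξ : M.obj a →ₗ[ℂ] ℂ)
    (h : ∀ (b : Paths Q) (_ : Quiver.Hom (V := Q) b a), Subsingleton (M.obj b)) :
    M ⟶ simpleRep Q a :=
  Paths.liftNatTrans (fun b => FGModuleCat.ofHom (toSimpleApp ξ b)) (fun {b c} f => by
    have h1 : FGModuleCat.ofHom (toSimpleApp ξ b) ≫ (simpleRep Q a).map f.toPath = 0 :=
      (congrArg (fun t => FGModuleCat.ofHom (toSimpleApp ξ b) ≫ t)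
        (simpleRep_map_toPath a f)).trans comp_zero
    exact (comp_toSimpleApp_eq_zero ξ h f _).trans h1.symm)

lemma epi_toSimple {M : RepFD Q} {a : Paths Q} (ξ : M.obj a →ₗ[ℂ] ℂ)
    (h : ∀ (b : Paths Q) (_ : Quiver.Hom (V := Q) b a), Subsingleton (M.obj b)) {x : M.obj a}
    (hx : ξ x ≠ 0) : Epi (toSimple ξ h) := by
  have hs : ∀ b, Function.Surjective (toSimpleApp ξ b) := by
    intro b y
    by_cases hb : b = a
    · subst hb
      refine ⟨(y ⟨rfl⟩ / ξ x) • x, ?_⟩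
      funext e
      rw [toSimpleApp_self, map_smul, smul_eq_mul, div_mul_cancel₀ _ hx]
    · exact ⟨0, funext fun e => (hb e.down).elim⟩
  have : ∀ b, Epi ((toSimple ξ h).app b) := fun b =>
    (forget₂ (FGModuleCat.{0} ℂ) (ModuleCat.{0} ℂ)).epi_of_epi_map
      ((ModuleCat.epi_iff_surjective _).2 (hs b))
  exact NatTrans.epi_of_epi_app _

instance [Fintype Q] : Fintype (Paths Q) :=
  inferInstanceAs (Fintype Q)

variable [Fintype Q]

/-- The total dimension of a representation. -/
def dimRep (M : RepFD Q) : ℕ := ∑ a : Paths Q, finrank ℂ ((atVertex Q a).obj M)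

lemma dimRep_iso {M N : RepFD Q} (e : M ≅ N) : dimRep M = dimRep N :=
  Finset.sum_congr rfl fun a _ => ((atVertex Q a).mapIso e).toLinearEquiv.finrank_eq

lemma dimRep_le_of_exact {S : ShortComplex (RepFD Q)} (hS : S.Exact) :
    dimRep S.X₂ ≤ dimRep S.X₁ + dimRep S.X₃ := by
  rw [dimRep, dimRep, dimRep, ← Finset.sum_add_distrib]
  refine Finset.sum_le_sum fun a _ => ?_
  have : ∀ M, Module.Finite ℂ ((atVertex Q a).obj M) := inferInstance
  exact @finrank_le_of_exact _ (hS.map (atVertex Q a)) (this _) (this _) (this _)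

lemma dimRep_eq_of_shortExact {S : ShortComplex (RepFD Q)} (hS : S.ShortExact) :
    dimRep S.X₂ = dimRep S.X₁ + dimRep S.X₃ := by
  rw [dimRep, dimRep, dimRep, ← Finset.sum_add_distrib]
  refine Finset.sum_congr rfl fun a _ => ?_
  have : ∀ M, Module.Finite ℂ ((atVertex Q a).obj M) := inferInstance
  exact @finrank_eq_of_shortExact _ (hS.map_of_exact (atVertex Q a)) (this _) (this _) (this _)

lemma dimRep_eq_zero_iff (M : RepFD Q) : dimRep M = 0 ↔ IsZero M := by
  constructor
  · intro h
    rw [Functor.isZero_iff]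
    intro a
    have h1 := (Finset.sum_eq_zero_iff.1 h) a (Finset.mem_univ a)
    rw [finrank_zero_iff] at h1
    rw [IsZero.iff_id_eq_zero]
    ext x
    exact Subsingleton.elim (α := (atVertex Q a).obj M) _ _
  · intro h
    refine Finset.sum_eq_zero fun a _ => ?_
    have := ModuleCat.subsingleton_of_isZero ((atVertex Q a).map_isZero h)
    exact finrank_zero_of_subsingleton

open Classical in
lemma dimRep_simpleRep (a : Paths Q) : dimRep (simpleRep Q a) = 1 := by
  have h : ∀ b, finrank ℂ ((atVertex Q b).obj (simpleRep Q a)) = if b = a then 1 else 0 := by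
    intro b
    change finrank ℂ (PLift (b = a) → ℂ) = _
    rw [finrank_fintype_fun_eq_card]
    split_ifs with hb
    · exact Fintype.card_eq_one_iff.2 ⟨⟨hb⟩, fun _ => rfl⟩
    · exact Fintype.card_eq_zero_iff.2 ⟨fun h => hb h.down⟩
  rw [dimRep, Finset.sum_congr rfl fun b _ => h b]
  simp

/-- A vertex in the support of `M` without arrows from the support. -/
lemma exists_source_of_support (hQ : IsAcyclicQuiver Q) {M : RepFD Q} (hM : ¬ IsZero M) :
    ∃ a : Paths Q, Nontrivial (M.obj a) ∧ ∀ (b : Paths Q) (_ : Quiver.Hom (V := Q) b a),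
      Subsingleton (M.obj b) := by
  -- Acyclicity makes the relation of being joined by a path of positive length irreflexive, hence
  -- well founded on the finite vertex set; a minimal vertex of the support is taken.
  let r : Q → Q → Prop := fun a b => ∃ p : Quiver.Path a b, 0 < p.length
  have : IsTrans Q r := ⟨fun a b c ⟨p, hp⟩ ⟨q, hq⟩ => ⟨p.comp q, by
    rw [Quiver.Path.length_comp]; omega⟩⟩
  have : Std.Irrefl r := ⟨fun a ⟨p, hp⟩ => by rw [hQ a p] at hp; simp at hp⟩
  have hwf : WellFounded r := Finite.wellFounded_of_trans_of_irrefl r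
  have hne : ({a : Q | Nontrivial (M.obj (a : Paths Q))} : Set Q).Nonempty := by
    by_contra hne
    rw [Set.not_nonempty_iff_eq_empty, Set.eq_empty_iff_forall_notMem] at hne
    refine hM ((dimRep_eq_zero_iff M).1 (Finset.sum_eq_zero fun a _ => ?_))
    have : Subsingleton (M.obj a) := not_nontrivial_iff_subsingleton.1 (hne a)
    exact finrank_zero_of_subsingleton (M := M.obj a)
  obtain ⟨a, ha, hmin⟩ := hwf.has_min _ hne
  exact ⟨a, ha, fun b f => not_nontrivial_iff_subsingleton.1
    fun hb => hmin b hb ⟨Quiver.Hom.toPath (V := Q) f, Nat.zero_lt_one⟩⟩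

/-- At a vertex receiving no arrow from the support, every linear functional extends to a morphism
to the simple representation. -/
lemma exists_epi_simpleRep (hQ : IsAcyclicQuiver Q) {M : RepFD Q} (hM : ¬ IsZero M) :
    ∃ (a : Paths Q) (f : M ⟶ simpleRep Q a), Epi f := by
  obtain ⟨a, ha, h⟩ := exists_source_of_support hQ hM
  obtain ⟨x, hx⟩ := exists_ne (0 : M.obj a)
  have hξ : ∃ ξ : M.obj a →ₗ[ℂ] ℂ, ξ x ≠ 0 := by
    by_contra! hall
    exact hx ((Module.forall_dual_apply_eq_zero_iff ℂ x).1 hall)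
  obtain ⟨ξ, hξ⟩ := hξ
  exact ⟨a, toSimple ξ h, epi_toSimple ξ h hξ⟩

end Representations

/-! ### Cohomology in the bounded derived category and its total dimension. -/

section DerivedCategory

open DerivedCategory

variable {Q : Type u} [Quiver.{v} Q] [HasDerivedCategory.{w} (RepFD Q)]

/-- The inclusion of the bounded derived category in the derived category. -/
abbrev dbι : DbQuiver Q ⥤ DerivedCategory (RepFD Q) := Bounded.ι

/-- A representation as an object of the bounded derived category. -/
def ofRep (M : RepFD Q) : DbQuiver Q :=
  ⟨(singleFunctor (RepFD Q) 0).obj M, ⟨0, inferInstance⟩, ⟨0, inferInstance⟩⟩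

lemma isZero_of_isZero_obj {E : DbQuiver Q} (h : IsZero E.obj) : IsZero E := by
  rw [IsZero.iff_id_eq_zero]
  exact dbι.map_injective (h.eq_of_src _ _)

lemma isZero_ofRep {M : RepFD Q} (h : IsZero M) : IsZero (ofRep M) :=
  isZero_of_isZero_obj ((singleFunctor (RepFD Q) 0).map_isZero h)

lemma map_preimage_commShiftIso_inv {X Y : DbQuiver Q}
    (δ : dbι.obj X ⟶ (dbι.obj Y)⟦(1 : ℤ)⟧) :
    dbι.map (dbι.preimage (δ ≫ (dbι.commShiftIso (1 : ℤ)).inv.app Y)) ≫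
      (dbι.commShiftIso (1 : ℤ)).hom.app Y = δ := by
  rw [Functor.map_preimage, Category.assoc, Iso.inv_hom_id_app]
  exact Category.comp_id _

/-- The triangle exists in the full derived category; since `dbι` is fully faithful, its morphisms
lift, the connecting one after correction by the shift isomorphism. -/
lemma exists_distinguished_ofRep {S : ShortComplex (RepFD Q)} (hS : S.ShortExact) :
    ∃ (f : ofRep S.X₁ ⟶ ofRep S.X₂) (g : ofRep S.X₂ ⟶ ofRep S.X₃)
      (h : ofRep S.X₃ ⟶ (ofRep S.X₁)⟦(1 : ℤ)⟧), Triangle.mk f g h ∈ (distTriang (DbQuiver Q)) := by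
  refine ⟨dbι.preimage ((singleFunctor (RepFD Q) 0).map S.f),
    dbι.preimage ((singleFunctor (RepFD Q) 0).map S.g),
    dbι.preimage (hS.singleδ ≫ (dbι.commShiftIso (1 : ℤ)).inv.app (ofRep S.X₁)), ?_⟩
  refine isomorphic_distinguished _ hS.singleTriangle_distinguished _
    (Triangle.isoMk _ _ (Iso.refl _) (Iso.refl _) (Iso.refl _) ?_ ?_ ?_)
  · refine (Category.comp_id _).trans ?_
    exact (dbι.map_preimage _).trans (Category.id_comp _).symm
  · refine (Category.comp_id _).trans ?_
    exact (dbι.map_preimage _).trans (Category.id_comp _).symm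
  · have h1 := map_preimage_commShiftIso_inv (X := ofRep S.X₃) (Y := ofRep S.X₁) hS.singleδ
    refine Eq.trans ?_ (h1.trans (Category.id_comp _).symm)
    refine (congrArg (fun t => _ ≫ t) (CategoryTheory.Functor.map_id _ _)).trans (Category.comp_id _)

lemma exists_iso_ofRep {E : DbQuiver Q} (h : standardHeart Q E) :
    ∃ M : RepFD Q, Nonempty (E ≅ ofRep M) := by
  obtain ⟨h1, h2⟩ := h
  have : IsLE E.obj 0 := ⟨h1⟩
  have : IsGE E.obj 0 := ⟨h2⟩
  obtain ⟨M, ⟨e⟩⟩ := exists_iso_singleFunctor_obj_of_isGE_of_isLE E.obj 0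
  exact ⟨M, ⟨dbι.preimageIso e⟩⟩

lemma ofRep_mem_heart (M : RepFD Q) : standardHeart Q (ofRep M) :=
  ⟨(inferInstance : IsLE ((singleFunctor (RepFD Q) 0).obj M) 0).le,
    (inferInstance : IsGE ((singleFunctor (RepFD Q) 0).obj M) 0).ge⟩

/-- The cohomology of an object of the bounded derived category. -/
def coh (k : ℤ) : DbQuiver Q ⥤ RepFD Q := dbι ⋙ homologyFunctor (RepFD Q) k

/-- Cohomology and shifts. -/
def cohShiftIso (n k : ℤ) (E : DbQuiver Q) : (coh k).obj (E⟦n⟧) ≅ (coh (n + k)).obj E :=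
  (homologyFunctor (RepFD Q) k).mapIso ((dbι.commShiftIso n).app E) ≪≫
    ((homologyFunctor (RepFD Q) 0).shiftIso n k (n + k) rfl).app E.obj

lemma coh_exact₂ {X Y Z : DbQuiver Q} {f : X ⟶ Y} {g : Y ⟶ Z} {h : Z ⟶ X⟦(1 : ℤ)⟧}
    (hd : Triangle.mk f g h ∈ (distTriang (DbQuiver Q))) (k : ℤ) :
    ∃ w, (ShortComplex.mk ((coh k).map f) ((coh k).map g) w).Exact :=
  ⟨_, HomologySequence.exact₂ _ (dbι.map_distinguished _ hd) k⟩

lemma mono_coh_map {X Y Z : DbQuiver Q} {f : X ⟶ Y} {g : Y ⟶ Z} {h : Z ⟶ X⟦(1 : ℤ)⟧}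
    (hd : Triangle.mk f g h ∈ (distTriang (DbQuiver Q))) {k k' : ℤ} (hk : k + 1 = k')
    (h0 : IsZero ((coh k).obj Z) ∨ IsZero ((coh k').obj X)) : Mono ((coh k').map f) := by
  have := HomologySequence.exact₁ _ (dbι.map_distinguished _ hd) k k' hk
  refine this.mono_g ?_
  rcases h0 with h0 | h0
  · exact h0.eq_of_src _ _
  · exact h0.eq_of_tgt _ _

lemma epi_coh_map {X Y Z : DbQuiver Q} {f : X ⟶ Y} {g : Y ⟶ Z} {h : Z ⟶ X⟦(1 : ℤ)⟧}
    (hd : Triangle.mk f g h ∈ (distTriang (DbQuiver Q))) {k k' : ℤ} (hk : k + 1 = k')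
    (h0 : IsZero ((coh k).obj Z) ∨ IsZero ((coh k').obj X)) : Epi ((coh k).map g) := by
  have := HomologySequence.exact₃ _ (dbι.map_distinguished _ hd) k k' hk
  refine this.epi_f ?_
  rcases h0 with h0 | h0
  · exact h0.eq_of_src _ _
  · exact h0.eq_of_tgt _ _

variable [Fintype Q]

/-- The dimension of the cohomology in degree `k`. -/
def dimCoh (k : ℤ) (E : DbQuiver Q) : ℕ := dimRep ((coh k).obj E)

lemma dimCoh_iso (k : ℤ) {E E' : DbQuiver Q} (e : E ≅ E') : dimCoh k E = dimCoh k E' :=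
  dimRep_iso ((coh k).mapIso e)

lemma dimCoh_shift (n k : ℤ) (E : DbQuiver Q) : dimCoh k (E⟦n⟧) = dimCoh (n + k) E :=
  dimRep_iso (cohShiftIso n k E)

lemma dimCoh_isZero (k : ℤ) {E : DbQuiver Q} (h : IsZero E) : dimCoh k E = 0 :=
  (dimRep_eq_zero_iff _).2 ((homologyFunctor (RepFD Q) k).map_isZero (dbι.map_isZero h))

lemma dimCoh_le {X Y Z : DbQuiver Q} {f : X ⟶ Y} {g : Y ⟶ Z} {h : Z ⟶ X⟦(1 : ℤ)⟧}
    (hd : Triangle.mk f g h ∈ (distTriang (DbQuiver Q))) (k : ℤ) :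
    dimCoh k Y ≤ dimCoh k X + dimCoh k Z := by
  obtain ⟨w, hw⟩ := coh_exact₂ hd k
  have := dimRep_le_of_exact hw
  dsimp only at this
  unfold dimCoh
  exact this

/-- The hypothesis kills every connecting map, so the long exact sequence splits into short exact
ones. -/
lemma dimCoh_eq_add {X Y Z : DbQuiver Q} {f : X ⟶ Y} {g : Y ⟶ Z} {h : Z ⟶ X⟦(1 : ℤ)⟧}
    (hd : Triangle.mk f g h ∈ (distTriang (DbQuiver Q)))
    (h0 : ∀ k, dimCoh k Z = 0 ∨ dimCoh (k + 1) X = 0) (k : ℤ) :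
    dimCoh k Y = dimCoh k X + dimCoh k Z := by
  unfold dimCoh at h0 ⊢
  simp only [dimRep_eq_zero_iff] at h0
  obtain ⟨w, hw⟩ := coh_exact₂ hd k
  have hm : Mono ((coh k).map f) :=
    mono_coh_map hd (sub_add_cancel k 1) (by simpa using h0 (k - 1))
  have he : Epi ((coh k).map g) := epi_coh_map hd rfl (h0 k)
  have := dimRep_eq_of_shortExact (S := ShortComplex.mk ((coh k).map f) ((coh k).map g) w)
    { exact := hw, mono_f := hm, epi_g := he }
  dsimp only at this
  exact this

lemma dimCoh_ofRep (M : RepFD Q) (k : ℤ) : dimCoh k (ofRep M) = if k = 0 then dimRep M else 0 := by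
  split_ifs with hk
  · subst hk
    exact dimRep_iso ((singleFunctorCompHomologyFunctorIso (RepFD Q) 0).app M)
  · refine (dimRep_eq_zero_iff _).2 ?_
    rcases lt_or_gt_of_ne hk with h | h
    · exact isZero_of_isGE ((singleFunctor (RepFD Q) 0).obj M) 0 k h
    · exact isZero_of_isLE ((singleFunctor (RepFD Q) 0).obj M) 0 k h

/-- The total dimension of the cohomology. -/
def totalDim (E : DbQuiver Q) : ENNReal := ∑' k : ℤ, (dimCoh k E : ENNReal)

/-- With values in `ENNReal` no summability has to be checked; finiteness follows later from
`exists_totalDim_eq_and_hasCost`. -/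
lemma totalDim_shift (n : ℤ) (E : DbQuiver Q) : totalDim (E⟦n⟧) = totalDim E := by
  simp only [totalDim, dimCoh_shift]
  exact (Equiv.addLeft n).tsum_eq fun k => (dimCoh k E : ENNReal)

lemma totalDim_iso {E E' : DbQuiver Q} (e : E ≅ E') : totalDim E = totalDim E' :=
  tsum_congr fun k => by rw [dimCoh_iso k e]

lemma totalDim_isZero {E : DbQuiver Q} (h : IsZero E) : totalDim E = 0 := by
  simp [totalDim, dimCoh_isZero _ h]

lemma totalDim_ofRep (M : RepFD Q) : totalDim (ofRep M) = dimRep M := by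
  rw [totalDim, tsum_eq_single 0 fun k hk => by rw [dimCoh_ofRep, if_neg hk, Nat.cast_zero],
    dimCoh_ofRep, if_pos rfl]

lemma totalDim_le {X Y Z : DbQuiver Q} {f : X ⟶ Y} {g : Y ⟶ Z} {h : Z ⟶ X⟦(1 : ℤ)⟧}
    (hd : Triangle.mk f g h ∈ (distTriang (DbQuiver Q))) :
    totalDim Y ≤ totalDim X + totalDim Z := by
  rw [totalDim, totalDim, totalDim, ← ENNReal.tsum_add]
  exact ENNReal.tsum_le_tsum fun k => by exact_mod_cast dimCoh_le hd k

lemma totalDim_eq_add {X Y Z : DbQuiver Q} {f : X ⟶ Y} {g : Y ⟶ Z} {h : Z ⟶ X⟦(1 : ℤ)⟧}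
    (hd : Triangle.mk f g h ∈ (distTriang (DbQuiver Q)))
    (h0 : ∀ k, dimCoh k Z = 0 ∨ dimCoh (k + 1) X = 0) :
    totalDim Y = totalDim X + totalDim Z := by
  rw [totalDim, totalDim, totalDim, ← ENNReal.tsum_add]
  exact tsum_congr fun k => by exact_mod_cast dimCoh_eq_add hd h0 k

lemma totalDim_retract {X Y : DbQuiver Q} (r : Retract X Y) : totalDim X ≤ totalDim Y := by
  refine ENNReal.tsum_le_tsum fun k => ?_
  have r' := r.map (coh k)
  have : Mono r'.i := mono_of_mono_fac r'.retract
  have hS : (ShortComplex.mk r'.i (cokernel.π r'.i) (by simp)).ShortExact :=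
    { exact := ShortComplex.exact_cokernel r'.i, mono_f := this, epi_g := inferInstance }
  have := dimRep_eq_of_shortExact hS
  exact_mod_cast (Nat.le_add_right _ _).trans this.ge

lemma totalDim_isTower_le {p : ℕ} {A : Fin p → DbQuiver Q} {E : DbQuiver Q} (h : IsTower A E) :
    totalDim E ≤ ∑ i, totalDim (A i) := by
  induction p generalizing E with
  | zero => simp [totalDim_isZero ((isTower_zero_iff _ _).1 h)]
  | succ p ih =>
    obtain ⟨X, f, g, k, hX, hd⟩ := (isTower_succ_iff _ _).1 h
    rw [Fin.sum_univ_castSucc]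
    exact (totalDim_le hd).trans (add_le_add_left (ih hX) _)

lemma dimCoh_isTower_eq_zero {p : ℕ} {A : Fin p → DbQuiver Q} {E : DbQuiver Q} (h : IsTower A E)
    {k : ℤ} (hA : ∀ i, dimCoh k (A i) = 0) : dimCoh k E = 0 := by
  induction p generalizing E with
  | zero => exact dimCoh_isZero k ((isTower_zero_iff _ _).1 h)
  | succ p ih =>
    obtain ⟨X, f, g, c, hX, hd⟩ := (isTower_succ_iff _ _).1 h
    have := dimCoh_le hd k
    rw [ih hX fun i => hA _, hA] at this
    omega

/-- The total dimension is additive on towers whose factors are shifted representations, the shifts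
being weakly decreasing. -/
lemma totalDim_isTower_eq {p : ℕ} {A : Fin p → DbQuiver Q} {E : DbQuiver Q} (h : IsTower A E)
    {s : Fin p → ℤ} (hs : Antitone s) (hA : ∀ i k, s i + k ≠ 0 → dimCoh k (A i) = 0) :
    totalDim E = ∑ i, totalDim (A i) := by
  induction p generalizing E with
  | zero => simp [totalDim_isZero ((isTower_zero_iff _ _).1 h)]
  | succ p ih =>
    obtain ⟨X, f, g, c, hX, hd⟩ := (isTower_succ_iff _ _).1 h
    rw [Fin.sum_univ_castSucc, ← ih hX (fun i j hij => hs (Fin.castSucc_le_castSucc_iff.2 hij))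
      fun i => hA _]
    refine totalDim_eq_add hd fun k => ?_
    -- The last factor lives only in degree `-s (Fin.last p)`, and the earlier ones in degrees at
    -- most that, so the target of the connecting map vanishes.
    by_cases hk : s (Fin.last p) + k = 0
    · refine Or.inr (dimCoh_isTower_eq_zero hX fun i => hA _ _ ?_)
      have := hs (Fin.le_last i.castSucc)
      omega
    · exact Or.inl (hA _ _ hk)

/-- Representations are iterated extensions of simple ones. -/
lemma exists_isTower_simple (hQ : IsAcyclicQuiver Q) (n : ℕ) (M : RepFD Q) (hM : dimRep M = n) :
    ∃ a : Fin n → Paths Q, IsTower (fun i => ofRep (simpleRep Q (a i))) (ofRep M) := by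
  induction n generalizing M with
  | zero =>
    exact ⟨fun i => i.elim0,
      (isTower_zero_iff _ _).2 (isZero_ofRep ((dimRep_eq_zero_iff M).1 hM))⟩
  | succ n ih =>
    have h0 : ¬ IsZero M := fun h => by
      rw [(dimRep_eq_zero_iff M).2 h] at hM
      omega
    obtain ⟨b, f, hf⟩ := exists_epi_simpleRep hQ h0
    have hS : (ShortComplex.mk (kernel.ι f) f (by simp)).ShortExact :=
      { exact := ShortComplex.exact_kernel f, mono_f := inferInstance, epi_g := hf }
    have hdim := dimRep_eq_of_shortExact hS
    simp only [dimRep_simpleRep, hM] at hdim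
    obtain ⟨a, ha⟩ := ih (kernel f) (by omega)
    obtain ⟨i, j, k, hd⟩ := exists_distinguished_ofRep hS
    refine ⟨Fin.snoc a b, (isTower_succ_iff _ _).2 ?_⟩
    simp only [Fin.snoc_castSucc]
    rw [show (Fin.snoc a b : Fin (n + 1) → Paths Q) (Fin.last n) = b from Fin.snoc_last _ _]
    exact ⟨_, i, j, k, ha, hd⟩

end DerivedCategory

/-- To prove a statement about all shifts of an object it suffices to prove it for one of them and
to shift by one in both directions. -/
lemma shift_induction {T : Type u} [Category.{v} T] [HasShift T ℤ] {p : ℤ → T → Prop} (hiso : ∀ n {E E' : T}, (E ≅ E') → p n E → p n E')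
    (hadd : ∀ n E, p n E → p (n + 1) (E⟦(1 : ℤ)⟧)) (hsub : ∀ n E, p n (E⟦(1 : ℤ)⟧) → p (n - 1) E)
    {E : T} (h : p 0 E) (n : ℤ) : p n (E⟦n⟧) := by
  induction n using Int.induction_on with
  | zero => exact hiso 0 ((shiftFunctorZero T ℤ).app E).symm h
  | succ n ih => exact hiso _ ((shiftFunctorAdd T (n : ℤ) 1).app E).symm (hadd _ _ ih)
  | pred n ih =>
    exact hsub _ _ (hiso _ ((shiftFunctorAdd' T (-(n : ℤ) - 1) 1 (-(n : ℤ)) (by ring)).app E) ih)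

/-! ### Shifts of classes and of semistable objects; central charges in a half plane. -/

section Shift

variable {T : Type u} [Category.{v} T] [HasZeroObject T] [HasShift T ℤ] [Preadditive T]
  [∀ n : ℤ, (shiftFunctor T n).Additive] [Pretriangulated T]

/-- The sign is `(-1)^n`, but only norms and membership in a subgroup depend on it later, so it is
not tracked. -/
lemma K0.cls_shift_eq_or (E : T) (n : ℤ) :
    K0.cls (E⟦n⟧) = K0.cls E ∨ K0.cls (E⟦n⟧) = -K0.cls E := by
  refine shift_induction (p := fun _ X => K0.cls X = K0.cls E ∨ K0.cls X = -K0.cls E)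
    (fun _ _ _ e h => by rwa [← K0.cls_iso e]) (fun _ X h => ?_) (fun _ X h => ?_) (.inl rfl) n
  · rw [K0.cls_shift_one, neg_inj, neg_eq_iff_eq_neg]
    exact h.symm
  · rw [K0.cls_shift_one, neg_inj, neg_eq_iff_eq_neg] at h
    exact h.symm

lemma StabilityCondition.P_shift_int (σ : StabilityCondition T) {φ : ℝ} {E : T} (h : σ.P φ E)
    (n : ℤ) : σ.P (φ + n) (E⟦n⟧) := by
  refine shift_induction (p := fun n X => σ.P (φ + n) X) (fun n _ _ e h => σ.P_iso _ e h)
    (fun n X h => ?_) (fun n X h => ?_) (by simpa using h) n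
  · have := σ.P_shift_one h
    push_cast
    rwa [← add_assoc]
  · rw [show φ + (n : ℝ) = φ + ((n - 1 : ℤ) : ℝ) + 1 by push_cast; ring] at h
    obtain ⟨E', h', ⟨e⟩⟩ := (σ.P_shift _ _).1 h
    exact σ.P_iso _ ((shiftFunctor T (1 : ℤ)).preimageIso e).symm h'

lemma IsTower.prop {P : ObjectProperty T} [P.IsTriangulated] [P.IsClosedUnderIsomorphisms]
    {p : ℕ} {A : Fin p → T} {E : T} (h : IsTower A E) (hA : ∀ i, P (A i)) : P E := by
  induction p generalizing E with
  | zero => exact P.prop_of_isZero ((isTower_zero_iff _ _).1 h)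
  | succ p ih =>
    obtain ⟨X, f, g, k, hX, hd⟩ := (isTower_succ_iff _ _).1 h
    exact P.ext_of_isTriangulatedClosed₂ _ hd (ih hX fun i => hA _) (hA _)

end Shift

/-- The union of the open upper half plane and the negative real axis. -/
def halfPlane : Set ℂ := {z | 0 < z.im ∨ z.im = 0 ∧ z.re < 0}

lemma halfPlane_add {z w : ℂ} (hz : z ∈ halfPlane) (hw : w ∈ halfPlane) : z + w ∈ halfPlane := by
  simp only [halfPlane, Set.mem_ofPred_eq, Complex.add_im, Complex.add_re] at *
  rcases hz with hz | ⟨hz, hz'⟩ <;> rcases hw with hw | ⟨hw, hw'⟩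
  · exact .inl (by linarith)
  · exact .inl (by linarith)
  · exact .inl (by linarith)
  · exact .inr ⟨by linarith, by linarith⟩

lemma mul_exp_mem_halfPlane {m φ : ℝ} (hm : 0 < m) (hφ : φ ∈ Set.Ioc (0 : ℝ) 1) :
    (m : ℂ) * Complex.exp (Complex.I * Real.pi * φ) ∈ halfPlane := by
  rw [show Complex.I * Real.pi * φ = ((Real.pi * φ : ℝ) : ℂ) * Complex.I by push_cast; ring]
  simp only [halfPlane, Set.mem_ofPred_eq, Complex.re_ofReal_mul, Complex.im_ofReal_mul,
    Complex.exp_ofReal_mul_I_re, Complex.exp_ofReal_mul_I_im]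
  rcases hφ.2.lt_or_eq with h | rfl
  · exact .inl (mul_pos hm (Real.sin_pos_of_pos_of_lt_pi (mul_pos Real.pi_pos hφ.1)
      (mul_lt_of_lt_one_right Real.pi_pos h)))
  · refine .inr ⟨by simp, by simpa using hm⟩

/-- The norm of a sum of `n` vectors taken from a finite family in the half plane is comparable
to `n`. -/
lemma exists_norm_sum_bounds {ι : Type*} [Finite ι] {z : ι → ℂ} (hz : ∀ a, z a ∈ halfPlane) :
    ∃ c C : ℝ, 0 < c ∧ 0 < C ∧ ∀ (n : ℕ) (a : Fin n → ι),
      c * n ≤ ‖∑ i, z (a i)‖ ∧ ‖∑ i, z (a i)‖ ≤ C * n := by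
  -- The functional `Im - ε Re` is positive on the whole finite family: a small `ε` keeps it
  -- positive in the open upper half plane, and any `ε > 0` makes it positive on the negative real
  -- axis.
  have hε : ∃ ε : ℝ, 0 < ε ∧ ∀ a, 0 < (z a).im - ε * (z a).re := by
    have h1 : ∀ a, ∀ᶠ ε : ℝ in nhdsWithin 0 (Set.Ioi 0), 0 < (z a).im - ε * (z a).re := by
      intro a
      rcases hz a with h | ⟨h, h'⟩
      · have : Filter.Tendsto (fun ε : ℝ => (z a).im - ε * (z a).re) (nhds 0)
            (nhds ((z a).im - 0 * (z a).re)) := Continuous.tendsto (by fun_prop) 0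
        exact (this.mono_left nhdsWithin_le_nhds).eventually_const_lt (by simpa using h)
      · filter_upwards [self_mem_nhdsWithin] with ε hε
        rw [h]
        nlinarith [Set.mem_Ioi.1 hε]
    obtain ⟨ε, h, h'⟩ := ((Filter.eventually_all.2 h1).and self_mem_nhdsWithin).exists
    exact ⟨ε, h', h⟩
  obtain ⟨ε, hε, h⟩ := hε
  have hc : ∃ c : ℝ, 0 < c ∧ ∀ a, c ≤ (z a).im - ε * (z a).re := by
    rcases isEmpty_or_nonempty ι with hι | hι
    · exact ⟨1, one_pos, fun a => hι.elim a⟩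
    · obtain ⟨a, ha⟩ := Finite.exists_min fun a => (z a).im - ε * (z a).re
      exact ⟨_, h a, ha⟩
  obtain ⟨c, hc, hcz⟩ := hc
  have hC : ∃ C : ℝ, 0 < C ∧ ∀ a, ‖z a‖ ≤ C := by
    rcases isEmpty_or_nonempty ι with hι | hι
    · exact ⟨1, one_pos, fun a => hι.elim a⟩
    · obtain ⟨a, ha⟩ := Finite.exists_max fun a => ‖z a‖
      exact ⟨‖z a‖ + 1, by positivity, fun b => (ha b).trans (by linarith)⟩
  obtain ⟨C, hC, hCz⟩ := hC
  -- The functional is at most `(1 + ε)‖w‖` at `w`, whence the lower constant.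
  refine ⟨c / (1 + ε), C, by positivity, hC, fun n a => ⟨?_, ?_⟩⟩
  · rw [div_mul_eq_mul_div, div_le_iff₀ (by positivity)]
    calc c * n = ∑ _i : Fin n, c := by simp [mul_comm]
      _ ≤ ∑ i, ((z (a i)).im - ε * (z (a i)).re) := Finset.sum_le_sum fun i _ => hcz _
      _ = (∑ i, z (a i)).im - ε * (∑ i, z (a i)).re := by
        rw [Finset.sum_sub_distrib, Complex.im_sum, Complex.re_sum, Finset.mul_sum]
      _ ≤ ‖∑ i, z (a i)‖ + ε * ‖∑ i, z (a i)‖ := by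
        have h1 := Complex.im_le_norm (∑ i, z (a i))
        have h2 := (neg_le_abs _).trans (Complex.abs_re_le_norm (∑ i, z (a i)))
        nlinarith
      _ = ‖∑ i, z (a i)‖ * (1 + ε) := by ring
  · calc ‖∑ i, z (a i)‖ ≤ ∑ i, ‖z (a i)‖ := norm_sum_le _ _
      _ ≤ ∑ _i : Fin n, C := Finset.sum_le_sum fun i _ => hCz _
      _ = C * n := by simp [mul_comm]

/-! ### Stability conditions with the standard heart: mass, dimension and cost. -/

section Heart

variable {Q : Type u} [Quiver.{v} Q] [HasDerivedCategory.{w} (RepFD Q)]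
  {τ : StabilityCondition (DbQuiver Q)}

lemma StabilityCondition.isZero_or_Z_mem_halfPlane {T : Type u} [Category.{v} T] [HasZeroObject T]
    [HasShift T ℤ] [Preadditive T] [∀ n : ℤ, (shiftFunctor T n).Additive] [Pretriangulated T]
    (τ : StabilityCondition T) {E : T} (h : τ.heart E) :
    IsZero E ∨ τ.Z (K0.cls E) ∈ halfPlane := by
  induction h with
  | of E h =>
    obtain ⟨φ, hφ, h⟩ := h
    refine or_iff_not_imp_left.2 fun h0 => ?_
    obtain ⟨m, hm, h'⟩ := τ.phase_eq φ E h h0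
    rw [h']
    exact mul_exp_mem_halfPlane hm hφ
  | ext t ht _ _ h₁ h₃ =>
    have hZ : τ.Z (K0.cls t.obj₂) = τ.Z (K0.cls t.obj₁) + τ.Z (K0.cls t.obj₃) := by
      rw [← map_add, K0.cls_eq_add (f := t.mor₁) (g := t.mor₂) (h := t.mor₃) ht]
    rcases h₁ with h₁ | h₁
    · rcases h₃ with h₃ | h₃
      · exact .inl (t.isZero₂_of_isZero₁₃ ht h₁ h₃)
      · rw [hZ, K0.cls_isZero h₁, map_zero, zero_add]
        exact .inr h₃
    · rcases h₃ with h₃ | h₃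
      · rw [hZ, K0.cls_isZero h₃, map_zero, add_zero]
        exact .inr h₁
      · rw [hZ]
        exact .inr (halfPlane_add h₁ h₃)

/-- The shift by `-(⌈φ⌉ - 1)` brings the phase into `(0, 1]`, that is, into the heart. -/
lemma exists_iso_shift_ofRep (hτ : τ.heart = standardHeart Q) {φ : ℝ} {A : DbQuiver Q}
    (h : τ.P φ A) : ∃ M : RepFD Q, Nonempty (A ≅ (ofRep M)⟦⌈φ⌉ - 1⟧) := by
  have h1 : τ.heart (A⟦-(⌈φ⌉ - 1)⟧) := by
    refine ExtClosure.of _ ⟨_, ?_, τ.P_shift_int h _⟩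
    push_cast
    constructor <;> linarith [Int.le_ceil φ, Int.ceil_lt_add_one φ]
  rw [hτ] at h1
  obtain ⟨M, ⟨e⟩⟩ := exists_iso_ofRep h1
  exact ⟨M, ⟨((shiftFunctorCompIsoId _ (-(⌈φ⌉ - 1)) (⌈φ⌉ - 1) (by ring)).app A).symm ≪≫
    (shiftFunctor _ (⌈φ⌉ - 1)).mapIso e⟩⟩

variable [Fintype Q]

lemma not_isZero_ofRep_simpleRep (a : Paths Q) : ¬ IsZero (ofRep (simpleRep Q a)) := fun h => by
  have := totalDim_isZero h
  rw [totalDim_ofRep, dimRep_simpleRep] at this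
  simp at this

/-- An induction principle for the bounded derived category, given a stability condition whose heart
is the standard one. -/
lemma prop_of_simple (hQ : IsAcyclicQuiver Q) (hτ : τ.heart = standardHeart Q)
    (P : ObjectProperty (DbQuiver Q)) [P.IsTriangulated] [P.IsClosedUnderIsomorphisms]
    (h : ∀ a, P (ofRep (simpleRep Q a))) (E : DbQuiver Q) : P E := by
  by_cases hE : IsZero E
  · exact P.prop_of_isZero hE
  -- The Harder–Narasimhan filtration takes the place of the filtration by cohomology: its factors
  -- are shifted representations, hence iterated extensions of shifted simples.
  · obtain ⟨H⟩ := τ.exists_hn E hE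
    refine H.tower.prop fun i => ?_
    obtain ⟨M, ⟨e⟩⟩ := exists_iso_shift_ofRep hτ (H.factor_mem i)
    obtain ⟨a, ha⟩ := exists_isTower_simple hQ _ M rfl
    exact P.prop_of_iso e.symm (P.le_shift _ _ (ha.prop fun i => h _))

lemma exists_isSplitGenerator (hQ : IsAcyclicQuiver Q) (hτ : τ.heart = standardHeart Q) :
    ∃ G : DbQuiver Q, IsSplitGenerator G := by
  refine ⟨⨁ fun a : Paths Q => ofRep (simpleRep Q a), ?_⟩
  rw [IsSplitGenerator, ObjectProperty.isClassicalTriangulatedGenerator_iff]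
  refine top_le_iff.1 fun E _ => prop_of_simple hQ hτ _ (fun a => ?_) E
  exact ObjectProperty.prop_of_retract _
    ⟨biproduct.ι (fun a : Paths Q => ofRep (simpleRep Q a)) a, biproduct.π _ a, by simp⟩
    (ObjectProperty.le_triangEnvelope _ _ ⟨PUnit.unit⟩)

/-- The classes of the simples span. Finite generation is what turns the support property into the
lower bound `exists_le_norm_Z`. -/
lemma moduleFinite_k0 (hQ : IsAcyclicQuiver Q) (hτ : τ.heart = standardHeart Q) :
    Module.Finite ℤ (K0 (DbQuiver Q)) := by
  let N : Submodule ℤ (K0 (DbQuiver Q)) :=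
    Submodule.span ℤ (Set.range fun a : Paths Q => K0.cls (ofRep (simpleRep Q a)))
  have h : ∀ E : DbQuiver Q, K0.cls E ∈ N := fun E => by
    by_cases hE : IsZero E
    · rw [K0.cls_isZero hE]
      exact N.zero_mem
    · obtain ⟨H⟩ := τ.exists_hn E hE
      rw [H.tower.cls_eq]
      refine N.sum_mem fun i _ => ?_
      obtain ⟨M, ⟨e⟩⟩ := exists_iso_shift_ofRep hτ (H.factor_mem i)
      obtain ⟨a, ha⟩ := exists_isTower_simple hQ _ M rfl
      have hM : K0.cls (ofRep M) ∈ N := by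
        rw [ha.cls_eq]
        exact N.sum_mem fun i _ => Submodule.subset_span ⟨_, rfl⟩
      rw [K0.cls_iso e]
      rcases K0.cls_shift_eq_or (ofRep M) (⌈H.phase i⌉ - 1) with h | h <;> rw [h]
      · exact hM
      · exact N.neg_mem hM
  have hN : N.mkQ.toAddMonoidHom = 0 := K0.hom_ext fun E => (Submodule.Quotient.mk_eq_zero N).2 (h E)
  have hN : N = ⊤ := by
    refine top_le_iff.1 fun x _ => ?_
    exact (Submodule.Quotient.mk_eq_zero N).1 (DFunLike.congr_fun hN x)
  exact ⟨hN ▸ Submodule.fg_span (Set.finite_range _)⟩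

lemma hasCost_ofRep (hQ : IsAcyclicQuiver Q) {G : DbQuiver Q} {q : ℕ}
    (hG : ∀ a, HasCost G q (ofRep (simpleRep Q a))) (M : RepFD Q) :
    HasCost G (dimRep M * q) (ofRep M) := by
  obtain ⟨a, ha⟩ := exists_isTower_simple hQ _ M rfl
  simpa using ha.hasCost fun i => hG (a i)

/-- Strictly decreasing phases have weakly decreasing ceilings, so `totalDim_isTower_eq` applies. -/
lemma totalDim_hn {E : DbQuiver Q} (H : HNFiltration τ.P E) {M : Fin (H.n + 1) → RepFD Q}
    (e : ∀ i, Nonempty (H.factor i ≅ (ofRep (M i))⟦⌈H.phase i⌉ - 1⟧)) :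
    totalDim E = ((∑ i, dimRep (M i) : ℕ) : ENNReal) := by
  rw [totalDim_isTower_eq H.tower (s := fun i => ⌈H.phase i⌉ - 1)
    (fun i j hij => sub_le_sub_right (Int.ceil_mono (H.phase_strictAnti.antitone hij)) _)
    fun i k hk => by
      rw [dimCoh_iso k (e i).some, dimCoh_shift, dimCoh_ofRep, if_neg hk]]
  push_cast
  exact Finset.sum_congr rfl fun i _ => by
    rw [totalDim_iso (e i).some, totalDim_shift, totalDim_ofRep]

/-- The total dimension of the cohomology bounds the cost. -/
lemma exists_totalDim_eq_and_hasCost (hQ : IsAcyclicQuiver Q) (hτ : τ.heart = standardHeart Q)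
    (E : DbQuiver Q) : ∃ N : ℕ, totalDim E = N ∧ ∀ (G : DbQuiver Q) (q : ℕ),
      (∀ a, HasCost G q (ofRep (simpleRep Q a))) → HasCost G (N * q) E := by
  by_cases hE : IsZero E
  · exact ⟨0, by simp [totalDim_isZero hE], fun G q _ => by simpa using hasCost_zero G hE⟩
  · obtain ⟨H⟩ := τ.exists_hn E hE
    choose M e using fun i => exists_iso_shift_ofRep hτ (H.factor_mem i)
    refine ⟨_, totalDim_hn H e, fun G q hG => ?_⟩
    rw [Finset.sum_mul]
    exact H.tower.hasCost fun i =>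
      ((hasCost_ofRep hQ hG (M i)).shift _).of_iso (e i).some.symm

/-- The mass is comparable to the total dimension of the cohomology. -/
lemma exists_mass_bounds_of_heart (hQ : IsAcyclicQuiver Q) (hτ : τ.heart = standardHeart Q) :
    ∃ c C : ℝ, 0 < c ∧ 0 < C ∧ ∀ E : {E : DbQuiver Q // ¬ IsZero E},
      c * (totalDim E.1).toReal ≤ τ.mass E ∧ τ.mass E ≤ C * (totalDim E.1).toReal := by
  have hz : ∀ a, τ.Z (K0.cls (ofRep (simpleRep Q a))) ∈ halfPlane := fun a =>
    (τ.isZero_or_Z_mem_halfPlane (hτ ▸ ofRep_mem_heart _)).resolve_left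
      (not_isZero_ofRep_simpleRep a)
  obtain ⟨c, C, hc, hC, h⟩ := exists_norm_sum_bounds hz
  have hA : ∀ (A : DbQuiver Q) (M : RepFD Q) (k : ℤ), (A ≅ (ofRep M)⟦k⟧) →
      c * dimRep M ≤ ‖τ.Z (K0.cls A)‖ ∧ ‖τ.Z (K0.cls A)‖ ≤ C * dimRep M := by
    intro A M k e
    have h1 : ‖τ.Z (K0.cls A)‖ = ‖τ.Z (K0.cls (ofRep M))‖ := by
      rw [K0.cls_iso e]
      rcases K0.cls_shift_eq_or (ofRep M) k with h | h <;> simp [h]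
    obtain ⟨a, ha⟩ := exists_isTower_simple hQ _ M rfl
    rw [h1, ha.cls_eq, map_sum]
    exact h _ a
  refine ⟨c, C, hc, hC, fun E => ?_⟩
  obtain ⟨H⟩ := τ.exists_hn E.1 E.2
  choose M e using fun i => exists_iso_shift_ofRep hτ (H.factor_mem i)
  rw [totalDim_hn H e, ENNReal.toReal_natCast, τ.mass_eq E H]
  push_cast
  rw [Finset.mul_sum, Finset.mul_sum]
  exact ⟨Finset.sum_le_sum fun i _ => (hA _ _ _ (e i).some).1,
    Finset.sum_le_sum fun i _ => (hA _ _ _ (e i).some).2⟩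

/-- Bounds complexity from below by total dimension. -/
lemma HasCost.totalDim_le {G E : DbQuiver Q} {p : ℕ} (h : HasCost G p E) :
    totalDim E ≤ p * totalDim G := by
  obtain ⟨Y, ⟨n, hY⟩, ⟨r⟩⟩ := h
  refine (totalDim_retract r).trans ((totalDim_isTower_le hY).trans ?_)
  simp [totalDim_shift]

end Heart

/-! ### Growth rates of pseudo-Anosov functors: entropy and translation length. -/

section PseudoAnosov

lemma tendsto_log_of_exponential_bounds {u : ℕ → ℝ} {a b ρ : ℝ} (ha : 0 < a) (hρ : 0 < ρ)
    (h : ∀ n, a * ρ ^ n ≤ u n ∧ u n ≤ b * ρ ^ n) :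
    Filter.Tendsto (fun n : ℕ => (1 / (n : ℝ)) * Real.log (u n)) Filter.atTop
      (nhds (Real.log ρ)) := by
  have hb : 0 < b := by
    have := (h 0).1.trans (h 0).2
    simp only [pow_zero, mul_one] at this
    exact ha.trans_le this
  have hlim : ∀ x : ℝ, Filter.Tendsto (fun n : ℕ => Real.log x / n + Real.log ρ) Filter.atTop
      (nhds (Real.log ρ)) := fun x => by
    simpa using (tendsto_const_div_atTop_nhds_zero_nat (Real.log x)).add_const (Real.log ρ)
  have hmul : ∀ {x : ℝ}, 0 < x → ∀ {n : ℕ}, 0 < n →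
      Real.log x / n + Real.log ρ = 1 / n * Real.log (x * ρ ^ n) := fun {x} hx {n} hn => by
    rw [Real.log_mul hx.ne' (pow_pos hρ n).ne', Real.log_pow]
    field_simp
  refine tendsto_of_tendsto_of_tendsto_of_le_of_le' (hlim a) (hlim b) ?_ ?_
  · filter_upwards [Filter.eventually_gt_atTop 0] with n hn
    rw [hmul ha hn]
    exact mul_le_mul_of_nonneg_left (Real.log_le_log (by positivity) (h n).1) (by positivity)
  · filter_upwards [Filter.eventually_gt_atTop 0] with n hn
    rw [hmul hb hn]
    have : 0 < u n := lt_of_lt_of_le (by positivity) (h n).1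
    exact mul_le_mul_of_nonneg_left (Real.log_le_log this (h n).2) (by positivity)

section General

variable {T : Type u} [Category.{v} T] [HasZeroObject T] [HasShift T ℤ] [Preadditive T]
  [∀ n : ℤ, (shiftFunctor T n).Additive] [Pretriangulated T]
  {F : T ≌ T} [F.functor.CommShift ℤ] [F.functor.IsTriangulated]
  {S : Set (StabilityCondition T)}

lemma PseudoAnosov.exists_diagonal (hF : PseudoAnosov F S) : ∃ a b : ℝ,
    hF.g.M = !![a, 0; 0, b] ∧ a * b = 1 ∧
      ((|a| = |hF.r| ∧ |b| = |hF.r|⁻¹) ∨ (|a| = |hF.r|⁻¹ ∧ |b| = |hF.r|)) := by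
  have hr : hF.r ≠ 0 := abs_pos.1 (zero_lt_one.trans hF.one_lt)
  rcases hF.M_eq with h | h
  · exact ⟨_, _, h, by field_simp, .inr ⟨by rw [one_div, abs_inv], rfl⟩⟩
  · exact ⟨_, _, h, by field_simp, .inl ⟨rfl, by rw [one_div, abs_inv]⟩⟩

lemma isHyperbolic_planeMap {a b ρ : ℝ} (hρ : 1 < ρ)
    (hab : (|a| = ρ ∧ |b| = ρ⁻¹) ∨ (|a| = ρ⁻¹ ∧ |b| = ρ)) :
    IsHyperbolic (planeMap !![a, 0; 0, b]) ρ :=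
  isHyperbolic_of_diagonal (fun z => by simp [planeMap_apply]) hρ hab

lemma PseudoAnosov.isHyperbolic (hF : PseudoAnosov F S) :
    IsHyperbolic (planeMap hF.g.M) |hF.r| := by
  obtain ⟨a, b, h, -, hab⟩ := hF.exists_diagonal
  rw [h]
  exact isHyperbolic_planeMap hF.one_lt hab

lemma PseudoAnosov.isHyperbolic_inv (hF : PseudoAnosov F S) :
    IsHyperbolic (planeMap hF.g.M⁻¹) |hF.r| := by
  obtain ⟨a, b, h, h1, hab⟩ := hF.exists_diagonal
  have : hF.g.M⁻¹ = !![b, 0; 0, a] := by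
    rw [h]
    refine Matrix.inv_eq_left_inv ?_
    rw [Matrix.mul_fin_two, Matrix.one_fin_two]
    simp [h1, mul_comm b a]
  rw [this]
  exact isHyperbolic_planeMap hF.one_lt (hab.symm.imp And.symm And.symm)

/-- The infimum is tested at `σ_F` itself, with `s = log |r|`. -/
lemma PseudoAnosov.translationLength_le (hF : PseudoAnosov F S) :
    translationLength F S ≤ ENNReal.ofReal (Real.log |hF.r|) := by
  obtain ⟨a, b, h, h1, hab⟩ := hF.exists_diagonal
  have hexp : Real.exp (Real.log |hF.r|) = |hF.r| :=
    Real.exp_log (zero_lt_one.trans hF.one_lt)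
  refine (iInf₂_le hF.σ hF.mem).trans ?_
  rw [hF.act_eq]
  refine hF.σ.dBbar_actGL_le hF.g h h1 (Real.log_nonneg hF.one_lt.le) ?_
  rw [hexp]
  exact hab.imp And.left And.right

end General

variable {Q : Type u} [Quiver.{v} Q] [HasDerivedCategory.{w} (RepFD Q)] [Fintype Q]

/-- In the distinguished component, masses are comparable to the total dimension of the
cohomology. -/
lemma exists_mass_bounds_of_mem (hQ : IsAcyclicQuiver Q) {σ : StabilityCondition (DbQuiver Q)}
    (hσ : σ ∈ distinguishedComponent Q) :
    ∃ c C : ℝ, 0 < c ∧ 0 < C ∧ ∀ E : {E : DbQuiver Q // ¬ IsZero E},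
      c * (totalDim E.1).toReal ≤ σ.mass E ∧ σ.mass E ≤ C * (totalDim E.1).toReal := by
  obtain ⟨τ, hτ, h⟩ := hσ
  obtain ⟨c, C, hc, hC, hb⟩ := exists_mass_bounds_of_heart hQ hτ
  have hd : StabilityCondition.dB σ τ < ⊤ := connectedComponent_subset_edist_lt_top τ σ h
  obtain ⟨A, hA, hA'⟩ := StabilityCondition.exists_mass_le_of_dB_lt_top hd
  rw [StabilityCondition.dB_comm] at hd
  obtain ⟨B, hB, hB'⟩ := StabilityCondition.exists_mass_le_of_dB_lt_top hd
  refine ⟨c / B, A * C, by positivity, by positivity, fun E => ⟨?_, ?_⟩⟩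
  · rw [div_mul_eq_mul_div, div_le_iff₀ hB, mul_comm _ B]
    exact (hb E).1.trans (hB' E)
  · rw [mul_assoc]
    exact (hA' E).trans (mul_le_mul_of_nonneg_left (hb E).2 hA.le)

variable {F : DbQuiver Q ≌ DbQuiver Q} [F.functor.CommShift ℤ] [F.functor.IsTriangulated]

/-- Exponential growth of the cohomology under the iterates of a pseudo-Anosov functor. -/
lemma PseudoAnosov.exists_totalDim_bounds (hQ : IsAcyclicQuiver Q)
    (hF : PseudoAnosov F (distinguishedComponent Q)) (E : {E : DbQuiver Q // ¬ IsZero E}) :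
    ∃ c c' C : ℝ, 0 < c ∧ 0 < c' ∧ ∀ n : ℕ,
      c * |hF.r| ^ n ≤ (totalDim (F.functor.obj^[n] E.1)).toReal ∧
      (totalDim (F.functor.obj^[n] E.1)).toReal ≤ C * |hF.r| ^ n ∧
      c' * |hF.r| ^ n ≤ (totalDim (F.inverse.obj^[n] E.1)).toReal := by
  obtain ⟨τ, hτ, -⟩ := id hF.mem
  have := moduleFinite_k0 hQ hτ
  obtain ⟨ε, hε, hdisc⟩ := hF.σ.exists_le_norm_Z
  obtain ⟨a, A, ha, hA, hmass⟩ := exists_mass_bounds_of_mem hQ hF.mem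
  obtain ⟨c, hc, h⟩ := (StabilityCondition.equivariant_functor hF.act_eq).exists_mass_bounds
    hF.isHyperbolic hF.one_lt hε hdisc E
  obtain ⟨c', hc', h'⟩ := (StabilityCondition.equivariant_inverse hF.act_eq).exists_mass_bounds
    hF.isHyperbolic_inv hF.one_lt hε hdisc E
  refine ⟨c / A, c' / A, hF.σ.mass E / a, by positivity, by positivity, fun n => ⟨?_, ?_, ?_⟩⟩
  · rw [div_mul_eq_mul_div, div_le_iff₀ hA, mul_comm _ A]
    exact (h n).1.trans (hmass ⟨_, _⟩).2
  · rw [div_mul_eq_mul_div, le_div_iff₀ ha, mul_comm _ a, mul_comm (hF.σ.mass E)]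
    exact (hmass ⟨_, _⟩).1.trans (h n).2
  · rw [div_mul_eq_mul_div, div_le_iff₀ hA, mul_comm _ A]
    exact (h' n).1.trans (hmass ⟨_, _⟩).2

/-- Total dimension carries the growth rate of masses from `σ_F` to every `σ` in the component,
where `le_dBbar_actAut` applies. -/
lemma PseudoAnosov.le_translationLength (hQ : IsAcyclicQuiver Q)
    (hF : PseudoAnosov F (distinguishedComponent Q)) (E : {E : DbQuiver Q // ¬ IsZero E}) :
    ENNReal.ofReal (Real.log |hF.r|) ≤ translationLength F (distinguishedComponent Q) := by
  obtain ⟨c, c', C, hc, hc', h⟩ := hF.exists_totalDim_bounds hQ E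
  refine le_iInf₂ fun σ hσ => ?_
  obtain ⟨a, A, ha, hA, hmass⟩ := exists_mass_bounds_of_mem hQ hσ
  refine σ.le_dBbar_actAut F E (zero_lt_one.trans hF.one_lt) (mul_pos ha hc) (mul_pos ha hc')
    (fun n => ?_) fun n => ?_
  · rw [mul_assoc]
    exact (mul_le_mul_of_nonneg_left (h n).1 ha.le).trans (hmass ⟨_, _⟩).1
  · rw [mul_assoc]
    exact (mul_le_mul_of_nonneg_left (h n).2.2 ha.le).trans (hmass ⟨_, _⟩).1

lemma exists_forall_hasCost_simple {G : DbQuiver Q} (hG : IsSplitGenerator G) :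
    ∃ q, 0 < q ∧ ∀ a, HasCost G q (ofRep (simpleRep Q a)) := by
  choose p hp using fun a : Paths Q => hG.exists_hasCost (ofRep (simpleRep Q a))
  refine ⟨∑ a, p a + 1, Nat.succ_pos _, fun a => (hp a).mono ?_⟩
  exact (Finset.single_le_sum (fun _ _ => Nat.zero_le _) (Finset.mem_univ a)).trans (Nat.le_succ _)

lemma PseudoAnosov.hasEntropy (hQ : IsAcyclicQuiver Q) (a : Paths Q)
    (hF : PseudoAnosov F (distinguishedComponent Q)) :
    HasEntropy F.functor (Real.log |hF.r|) := by
  obtain ⟨τ, hτ, -⟩ := id hF.mem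
  refine ⟨exists_isSplitGenerator hQ hτ, fun G hG => ?_⟩
  have hG0 : ¬ IsZero G := fun h0 => by
    obtain ⟨p, hp⟩ := hG.exists_hasCost (ofRep (simpleRep Q a))
    have := hp.totalDim_le
    rw [totalDim_ofRep, dimRep_simpleRep, totalDim_isZero h0] at this
    simp at this
  obtain ⟨c, c', C, hc, -, h⟩ := hF.exists_totalDim_bounds hQ ⟨G, hG0⟩
  obtain ⟨q, hq, hqG⟩ := exists_forall_hasCost_simple hG
  obtain ⟨L, hL, -⟩ := exists_totalDim_eq_and_hasCost hQ hτ G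
  have hρ : 0 < |hF.r| := zero_lt_one.trans hF.one_lt
  -- Case `n = 0` of the lower growth bound.
  have hL0 : 0 < (L : ℝ) := by
    have := (h 0).1
    simp only [pow_zero, mul_one, Function.iterate_zero, id, hL, ENNReal.toReal_natCast] at this
    exact hc.trans_le this
  -- With `N` the total dimension of `Fⁿ G`, the complexity lies between `N / L` and `N * q`.
  refine tendsto_log_of_exponential_bounds (a := c / L) (b := C * q) (by positivity) hρ fun n => ?_
  obtain ⟨N, hN, hcost⟩ := exists_totalDim_eq_and_hasCost hQ hτ (F.functor.obj^[n] G)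
  obtain ⟨h1, h2, -⟩ := h n
  simp only [hN, ENNReal.toReal_natCast] at h1 h2
  have hN0 : 0 < N := by
    exact_mod_cast (show (0 : ℝ) < c * |hF.r| ^ n by positivity).trans_le h1
  have hcost := hcost G q hqG
  have hδ := (hasCost_complexity
    (not_isZero_functor_iterate F hG0 n) hcost).2.totalDim_le
  constructor
  · rw [hL, hN] at hδ
    have hδ : (N : ℝ) ≤ complexity G (F.functor.obj^[n] G) * L := by exact_mod_cast hδ
    rw [div_mul_eq_mul_div, div_le_iff₀ hL0]
    exact h1.trans hδ
  · have hle : (complexity G (F.functor.obj^[n] G) : ℝ) ≤ N * q := by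
      exact_mod_cast complexity_le (Nat.mul_pos hN0 hq) hcost
    calc (complexity G (F.functor.obj^[n] G) : ℝ) ≤ N * q := hle
      _ ≤ C * |hF.r| ^ n * q := by gcongr
      _ = C * q * |hF.r| ^ n := by ring

end PseudoAnosov

end

end StabMetric

theorem corollary4p10 (Q : Type u) [Quiver.{v} Q] [Finite Q] [∀ a b : Q, Finite (a ⟶ b)]
    (hconn : StabMetric.IsConnectedQuiver Q) (hacyc : StabMetric.IsAcyclicQuiver Q)
    [HasDerivedCategory.{w} (StabMetric.RepFD Q)]
    (F : StabMetric.DbQuiver Q ≌ StabMetric.DbQuiver Q)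
    [F.functor.CommShift ℤ] [F.functor.IsTriangulated]
    (hF : StabMetric.PseudoAnosov F (StabMetric.distinguishedComponent Q)) :
    StabMetric.HasEntropy F.functor (Real.log hF.stretchFactor) ∧
      StabMetric.translationLength F (StabMetric.distinguishedComponent Q) =
        ENNReal.ofReal (Real.log hF.stretchFactor) := by
  have := Fintype.ofFinite Q
  obtain ⟨a⟩ := hconn.1
  let s : StabMetric.DbQuiver Q := StabMetric.ofRep (StabMetric.simpleRep Q a)
  exact ⟨hF.hasEntropy hacyc a, le_antisymm hF.translationLength_le
    (hF.le_translationLength hacyc ⟨s, StabMetric.not_isZero_ofRep_simpleRep a⟩)⟩
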